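/- Work in the ring $\mathbb C[[z_1,z_2]]$ and write $\theta_i=z_i\,\partial/\partial z_i$. Let $$\mathcal L_1=\theta_1(\theta_1-3\theta_2)-12z_1(6\theta_1+1)(6\theta_1+5),\qquad \mathcal L_2=\theta_2^3+z_2(3\theta_2-\theta_1)(3\theta_2-\theta_1+1)(3\theta_2-\theta_1+2)$$ be the Picard–Fuchs operators of the mirror of $X_{18}(1,1,1,6,9)$, and $$\Delta_1=(1-432z_1)^3-27z_2(432z_1)^3,\qquad \Delta_2=1+27z_2 .$$ Let $X_0$ be the fundamental period, i.e. the power series solution of $\mathcal L_1w=\mathcal L_2w=0$ with constant term $1$, $$X_0=\sum_{n\ge 3m\ge 0}\frac{(6n)!}{(n-3m)!\,(2n)!\,(3n)!\,(m!)^3}\,z_1^nz_2^m=1+60z_1+\cdots,$$ and let $X_1=X_0\log z_1+S$ be the logarithmic solution with $S\in\mathbb C[[z_1,z_2]]$, $S(0,0)=0$ (so $S=312z_1+2z_2+\cdots$; explicitly, the coefficient of $z_1^nz_2^m$ in $S$ is the derivative at $\rho=0$ of $\Gamma(6(n+\rho)+1)/\big(\Gamma(n+\rho-3m+1)\Gamma(2(n+\rho)+1)\Gamma(3(n+\rho)+1)\Gamma(m+1)^3\big)$).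 Put $$q_E=\exp(X_1/X_0)=z_1\exp(S/X_0)\in\mathbb C[[z_1,z_2]].$$ Let $E_4,E_6$ be the Eisenstein series of $SL(2,\mathbb Z)$ normalised to have constant term $1$ and let $\eta^{24}=q\prod_{k\ge1}(1-q^k)^{24}$; substitute $q=q_E$ in their $q$-expansions. Fractional powers of $E_4(q_E)=1+\cdots$ are the formal ones with constant term $1$. Put $$Z=\frac{z_2}{(1-432z_1)^3\,E_4(q_E)^{9/2}} .$$ **Theorem (Conjecture 3.75).** There are unique sequences $a_n,b_n,c_n,x_n$ ($n\ge0$) of power series in $\mathbb C[[q]]$ such that, in $\mathbb C[[z_1,z_2]]$, $$z_1(1-432z_1)=\frac{\eta(q_E)^{24}}{E_4(q_E)^3}\sum_{n\ge0}a_n(q_E)Z^n,\qquad \frac{\Delta_1\Delta_2}{(1-432z_1)^3}=\sum_{n\ge0}b_n(q_E)Z^n,$$ $$1-864z_1=\frac1{E_4(q_E)^{3/2}}\sum_{n\ge0}c_n(q_E)Z^n,\qquad X_0=E_4(q_E)^{1/4}\sum_{n\ge0}x_n(q_E)Z^n .$$ Their leading terms are $a_0=b_0=x_0=1$ and $c_0=E_6$.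 For every $n\ge0$, $a_n$, $b_n$ and $x_n$ are $q$-expansions of holomorphic modular forms of weight $18n$ for $SL(2,\mathbb Z)$, and $c_n$ is the $q$-expansion of a holomorphic modular form of weight $18n+6$ for $SL(2,\mathbb Z)$; in particular none of them involves $E_2$. Moreover, for every $n\ge1$, $c_n$ and $x_n$ are divisible by $\eta^{24}$: $c_n=\eta^{24}g_n$ and $x_n=\eta^{24}h_n$ with $g_n$, $h_n$ holomorphic modular forms for $SL(2,\mathbb Z)$ of weights $18n-6$ and $18n-12$. -/

import Mathlib

open scoped MatrixGroups PowerSeries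

noncomputable section

namespace X18

open MvPowerSeries

/-! ### Power series in the two complex structure variables and the Picard-Fuchs system -/

/-- Formal power series in `z₁, z₂` with complex coefficients. -/
abbrev Ser : Type := MvPowerSeries (Fin 2) ℂ

/-- The variable `z₁` (elliptic fibre). -/
def z₁ : Ser := X 0

/-- The variable `z₂` (base). -/
def z₂ : Ser := X 1

/-- The pair `(A, B)` stands for the series `A * log z₁ + B`. -/
abbrev LogSer : Type := Ser × Ser

/-- `z₁ ∂/∂z₁` (`i = 0`) or `z₂ ∂/∂z₂` (`i = 1`) on power series. -/
def euler (i : Fin 2) : Module.End ℂ Ser :=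
  LinearMap.mulLeft ℂ (X i) * (pderiv ℂ i : Ser →ₗ[ℂ] Ser)

/-- `z₁ ∂/∂z₁ (A log z₁ + B) = (z₁ ∂A/∂z₁) log z₁ + (A + z₁ ∂B/∂z₁)`. -/
def θ₁ : Module.End ℂ LogSer :=
  LinearMap.prodMap (euler 0) (euler 0) + LinearMap.inr ℂ Ser Ser ∘ₗ LinearMap.fst ℂ Ser Ser

/-- `z₂ ∂/∂z₂ (A log z₁ + B) = (z₂ ∂A/∂z₂) log z₁ + z₂ ∂B/∂z₂`. -/
def θ₂ : Module.End ℂ LogSer := LinearMap.prodMap (euler 1) (euler 1)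

/-- Multiplication by a power series. -/
def mulBy (F : Ser) : Module.End ℂ LogSer := Algebra.lsmul ℂ ℂ LogSer F

/-- `θ₁ (θ₁ - 3 θ₂) - 12 z₁ (6 θ₁ + 1) (6 θ₁ + 5)`. -/
def L₁ : Module.End ℂ LogSer :=
  θ₁ * (θ₁ - 3 * θ₂) - 12 * mulBy z₁ * ((6 * θ₁ + 1) * (6 * θ₁ + 5))

/-- `θ₂ ^ 3 + z₂ (3 θ₂ - θ₁) (3 θ₂ - θ₁ + 1) (3 θ₂ - θ₁ + 2)`. -/
def L₂ : Module.End ℂ LogSer :=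
  θ₂ ^ 3 + mulBy z₂ * ((3 * θ₂ - θ₁) * (3 * θ₂ - θ₁ + 1) * (3 * θ₂ - θ₁ + 2))

/-! ### The periods -/

/-- The coefficient of `z₁ ^ n z₂ ^ m` in the fundamental period, that is
`Γ(6n+1) / (Γ(n-3m+1) Γ(2n+1) Γ(3n+1) Γ(m+1)^3)`, which vanishes for `n < 3m`. -/
def periodCoeff (n m : ℕ) : ℂ :=
  if 3 * m ≤ n then
    ((6 * n).factorial : ℂ) / ((n - 3 * m).factorial * (2 * n).factorial * (3 * n).factorial
      * (m.factorial : ℂ) ^ 3)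
  else 0

/-- The derivative at `ρ = 0` of
`Γ(6(n+ρ)+1) / (Γ(n+ρ-3m+1) Γ(2(n+ρ)+1) Γ(3(n+ρ)+1) Γ(m+1)^3)`. -/
def logCoeff (n m : ℕ) : ℂ :=
  if 3 * m ≤ n then
    periodCoeff n m * ((6 * harmonic (6 * n) - 2 * harmonic (2 * n) - 3 * harmonic (3 * n)
      - harmonic (n - 3 * m) : ℚ) : ℂ)
  else
    (-1) ^ (3 * m - n - 1) * ((3 * m - n - 1).factorial : ℂ) * ((6 * n).factorial : ℂ)
      / ((2 * n).factorial * (3 * n).factorial * (m.factorial : ℂ) ^ 3)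

/-- The fundamental period `X₀`. -/
def X₀ : Ser := fun d => periodCoeff (d 0) (d 1)

/-- The power series part of the period `X₁ = X₀ log z₁ + S`. -/
def S : Ser := fun d => logCoeff (d 0) (d 1)

theorem coeff_euler (i : Fin 2) (F : Ser) (d : Fin 2 →₀ ℕ) :
    coeff d (euler i F) = (d i : ℂ) * coeff d F := by
  have h : euler i F = X i * pderiv ℂ i F := rfl
  rw [h]
  by_cases hd : d i = 0
  · have : (X i : Ser) ∣ X i * pderiv ℂ i F := Dvd.intro _ rfl
    rw [X_dvd_iff.1 this d hd, hd]; simp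
  · have hle : Finsupp.single i 1 ≤ d := by
      rw [Finsupp.single_le_iff]; omega
    obtain ⟨e, rfl⟩ := exists_add_of_le hle
    have h1 := coeff_add_monomial_mul (Finsupp.single i 1) e (pderiv ℂ i F) (1 : ℂ)
    rw [← X_def] at h1
    rw [h1, coeff_pderiv, add_comm e]
    simp; ring

/-- The exponent of `z₁ ^ n z₂ ^ m`. -/
def ex (n m : ℕ) : Fin 2 →₀ ℕ := Finsupp.single 0 n + Finsupp.single 1 m

theorem ex_zero (n m : ℕ) : ex n m 0 = n := by simp [ex]

theorem ex_one (n m : ℕ) : ex n m 1 = m := by simp [ex]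

theorem ser_ext {F G : Ser} (h : ∀ n m, coeff (ex n m) F = coeff (ex n m) G) : F = G := by
  ext d
  have : d = ex (d 0) (d 1) := by
    ext i; fin_cases i <;> simp [ex]
  rw [this]; exact h _ _

theorem coeff_z₁_mul_zero (F : Ser) (m : ℕ) : coeff (ex 0 m) (z₁ * F) = 0 :=
  X_dvd_iff.1 (Dvd.intro F rfl : (X 0 : Ser) ∣ z₁ * F) _ (ex_zero 0 m)

theorem coeff_z₁_mul_succ (F : Ser) (n m : ℕ) :
    coeff (ex (n + 1) m) (z₁ * F) = coeff (ex n m) F := by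
  have h1 := coeff_add_monomial_mul (Finsupp.single 0 1) (ex n m) F (1 : ℂ)
  rw [← X_def, one_mul] at h1
  rw [← h1, z₁]; congr 2
  simp [ex, Finsupp.single_add]; abel

theorem coeff_z₂_mul_zero (F : Ser) (n : ℕ) : coeff (ex n 0) (z₂ * F) = 0 :=
  X_dvd_iff.1 (Dvd.intro F rfl : (X 1 : Ser) ∣ z₂ * F) _ (ex_one n 0)

theorem coeff_z₂_mul_succ (F : Ser) (n m : ℕ) :
    coeff (ex n (m + 1)) (z₂ * F) = coeff (ex n m) F := by
  have h1 := coeff_add_monomial_mul (Finsupp.single 1 1) (ex n m) F (1 : ℂ)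
  rw [← X_def, one_mul] at h1
  rw [← h1, z₂]; congr 2
  simp [ex, Finsupp.single_add]; abel

theorem coeff_θ₁_fst (d : Fin 2 →₀ ℕ) (w : LogSer) :
    coeff d (θ₁ w).1 = (d 0 : ℂ) * coeff d w.1 := by
  simp [θ₁, coeff_euler]

theorem coeff_θ₁_snd (d : Fin 2 →₀ ℕ) (w : LogSer) :
    coeff d (θ₁ w).2 = (d 0 : ℂ) * coeff d w.2 + coeff d w.1 := by
  simp [θ₁, coeff_euler]

theorem coeff_θ₂_fst (d : Fin 2 →₀ ℕ) (w : LogSer) :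
    coeff d (θ₂ w).1 = (d 1 : ℂ) * coeff d w.1 := by
  simp [θ₂, coeff_euler]

theorem coeff_θ₂_snd (d : Fin 2 →₀ ℕ) (w : LogSer) :
    coeff d (θ₂ w).2 = (d 1 : ℂ) * coeff d w.2 := by
  simp [θ₂, coeff_euler]

theorem mulBy_apply (F : Ser) (w : LogSer) : mulBy F w = (F * w.1, F * w.2) := rfl

theorem numeral_eq (k : ℕ) [k.AtLeastTwo] : (OfNat.ofNat k : Module.End ℂ LogSer)
    = (OfNat.ofNat k : ℂ) • 1 := by
  rw [← Algebra.algebraMap_eq_smul_one, map_ofNat]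

theorem L₁_apply (w : LogSer) : L₁ w = θ₁ (θ₁ w) - (3 : ℂ) • θ₁ (θ₂ w)
    - (12 : ℂ) • mulBy z₁ ((36 : ℂ) • θ₁ (θ₁ w) + (36 : ℂ) • θ₁ w + (5 : ℂ) • w) := by
  have h3 : (3 : Module.End ℂ LogSer) = (3 : ℂ) • 1 := numeral_eq 3
  have h6 : (6 : Module.End ℂ LogSer) = (6 : ℂ) • 1 := numeral_eq 6
  have h5 : (5 : Module.End ℂ LogSer) = (5 : ℂ) • 1 := numeral_eq 5
  have h12 : (12 : Module.End ℂ LogSer) = (12 : ℂ) • 1 := numeral_eq 12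
  rw [L₁, h3, h6, h5, h12]
  simp only [LinearMap.sub_apply, Module.End.mul_apply, LinearMap.add_apply, LinearMap.smul_apply,
    Module.End.one_apply, map_sub, map_add, map_smul]
  module

theorem L₂_apply (w : LogSer) : ∃ T : Module.End ℂ LogSer,
    (∀ v, T v = (3 : ℂ) • θ₂ v - θ₁ v) ∧
    L₂ w = θ₂ (θ₂ (θ₂ w)) + mulBy z₂ (T (T (T w + (2 : ℂ) • w) + (T w + (2 : ℂ) • w))) := by
  have h3 : (3 : Module.End ℂ LogSer) = (3 : ℂ) • 1 := numeral_eq 3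
  have h2 : (2 : Module.End ℂ LogSer) = (2 : ℂ) • 1 := numeral_eq 2
  refine ⟨3 * θ₂ - θ₁, fun v => ?_, ?_⟩
  · rw [h3]; simp
  · rw [L₂, h2]; rfl

theorem coeff_L₁_fst_zero (w : LogSer) (m : ℕ) : coeff (ex 0 m) (L₁ w).1 = 0 := by
  rw [L₁_apply]
  simp [mulBy_apply, coeff_θ₁_fst, coeff_z₁_mul_zero, ex_zero]

theorem coeff_L₁_snd_zero (w : LogSer) (m : ℕ) :
    coeff (ex 0 m) (L₁ w).2 = -3 * m * coeff (ex 0 m) w.1 := by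
  rw [L₁_apply]
  simp [mulBy_apply, coeff_θ₁_fst, coeff_θ₁_snd, coeff_θ₂_fst, coeff_θ₂_snd, coeff_z₁_mul_zero,
    ex_zero, ex_one]
  ring

theorem coeff_L₁_fst_succ (w : LogSer) (n m : ℕ) :
    coeff (ex (n + 1) m) (L₁ w).1 = (n + 1) * (n + 1 - 3 * m) * coeff (ex (n + 1) m) w.1
      - 12 * (6 * n + 1) * (6 * n + 5) * coeff (ex n m) w.1 := by
  rw [L₁_apply]
  simp [mulBy_apply, coeff_θ₁_fst, coeff_θ₂_fst, coeff_z₁_mul_succ, ex_zero, ex_one]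
  ring

theorem coeff_L₁_snd_succ (w : LogSer) (n m : ℕ) :
    coeff (ex (n + 1) m) (L₁ w).2 = (n + 1) * (n + 1 - 3 * m) * coeff (ex (n + 1) m) w.2
      + (2 * (n + 1) - 3 * m) * coeff (ex (n + 1) m) w.1
      - 12 * ((6 * n + 1) * (6 * n + 5) * coeff (ex n m) w.2
        + (72 * n + 36) * coeff (ex n m) w.1) := by
  rw [L₁_apply]
  simp [mulBy_apply, coeff_θ₁_fst, coeff_θ₁_snd, coeff_θ₂_fst, coeff_θ₂_snd, coeff_z₁_mul_succ,
    ex_zero, ex_one]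
  ring

theorem coeff_L₂_fst_zero (w : LogSer) (n : ℕ) : coeff (ex n 0) (L₂ w).1 = 0 := by
  obtain ⟨T, -, h⟩ := L₂_apply w
  rw [h]
  simp [mulBy_apply, coeff_θ₂_fst, coeff_z₂_mul_zero, ex_one]

theorem coeff_L₂_snd_zero (w : LogSer) (n : ℕ) : coeff (ex n 0) (L₂ w).2 = 0 := by
  obtain ⟨T, -, h⟩ := L₂_apply w
  rw [h]
  simp [mulBy_apply, coeff_θ₂_snd, coeff_z₂_mul_zero, ex_one]

theorem coeff_L₂_fst_succ (w : LogSer) (n m : ℕ) :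
    coeff (ex n (m + 1)) (L₂ w).1 = (m + 1) ^ 3 * coeff (ex n (m + 1)) w.1
      + (3 * m - n) * (3 * m - n + 1) * (3 * m - n + 2) * coeff (ex n m) w.1 := by
  obtain ⟨T, hT, h⟩ := L₂_apply w
  rw [h]
  simp [mulBy_apply, hT, coeff_θ₁_fst, coeff_θ₂_fst, coeff_z₂_mul_succ, ex_zero, ex_one]
  ring

theorem coeff_L₂_snd_succ (w : LogSer) (n m : ℕ) :
    coeff (ex n (m + 1)) (L₂ w).2 = (m + 1) ^ 3 * coeff (ex n (m + 1)) w.2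
      + (3 * m - n) * (3 * m - n + 1) * (3 * m - n + 2) * coeff (ex n m) w.2
      - (3 * (3 * m - n) ^ 2 + 6 * (3 * m - n) + 2) * coeff (ex n m) w.1 := by
  obtain ⟨T, hT, h⟩ := L₂_apply w
  rw [h]
  simp [mulBy_apply, hT, coeff_θ₁_fst, coeff_θ₂_fst, coeff_θ₁_snd, coeff_θ₂_snd,
    coeff_z₂_mul_succ, ex_zero, ex_one]
  ring

/-- A solution of the Picard-Fuchs system is determined by the constant terms of its two
components. -/
theorem solution_unique (w : LogSer) (h1 : L₁ w = 0) (h2 : L₂ w = 0)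
    (hA : coeff (ex 0 0) w.1 = 0) (hB : coeff (ex 0 0) w.2 = 0) : w = 0 := by
  have hm (m : ℕ) : ((m : ℂ) + 1) ≠ 0 := by exact_mod_cast Nat.succ_ne_zero m
  have key1 : ∀ m n, coeff (ex n m) w.1 = 0 := by
    intro m
    induction m with
    | zero =>
      intro n
      induction n with
      | zero => exact hA
      | succ n ih =>
        have := coeff_L₁_fst_succ w n 0
        simpa [h1, ih, hm] using this
    | succ m ih =>
      intro n
      have := coeff_L₂_fst_succ w n m
      simpa [h2, ih, hm] using this
  have key2 : ∀ m n, coeff (ex n m) w.2 = 0 := by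
    intro m
    induction m with
    | zero =>
      intro n
      induction n with
      | zero => exact hB
      | succ n ih =>
        have := coeff_L₁_snd_succ w n 0
        simpa [h1, ih, hm, key1] using this
    | succ m ih =>
      intro n
      have := coeff_L₂_snd_succ w n m
      simpa [h2, ih, hm, key1] using this
  refine Prod.ext (ser_ext fun n m => ?_) (ser_ext fun n m => ?_)
  · simpa using key1 m n
  · simpa using key2 m n

theorem coeff_X₀ (n m : ℕ) : coeff (ex n m) X₀ = periodCoeff n m := by
  change periodCoeff (ex n m 0) (ex n m 1) = _
  rw [ex_zero, ex_one]

theorem coeff_S (n m : ℕ) : coeff (ex n m) S = logCoeff n m := by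
  change logCoeff (ex n m 0) (ex n m 1) = _
  rw [ex_zero, ex_one]

/-- `Γ(6n+1) / (Γ(2n+1) Γ(3n+1))`. -/
def fib (n : ℕ) : ℂ := ((6 * n).factorial : ℂ) / ((2 * n).factorial * (3 * n).factorial)

/-- The logarithmic derivative of `Γ(6n+1) / (Γ(2n+1) Γ(3n+1))`, up to Euler constants, which
cancel against the one in `drg`. -/
def har (n : ℕ) : ℂ :=
  ((6 * harmonic (6 * n) - 2 * harmonic (2 * n) - 3 * harmonic (3 * n) : ℚ) : ℂ)

/-- `1 / Γ(k+1)` on integers. -/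
def rg : ℤ → ℂ
  | Int.ofNat k => 1 / (k.factorial : ℂ)
  | Int.negSucc _ => 0

/-- The derivative of `1 / Γ(k+1)` on integers, up to Euler constants. -/
def drg : ℤ → ℂ
  | Int.ofNat k => -((harmonic k : ℚ) : ℂ) / (k.factorial : ℂ)
  | Int.negSucc j => (-1) ^ j * (j.factorial : ℂ)

theorem fac_ne (k : ℕ) : (k.factorial : ℂ) ≠ 0 := by exact_mod_cast k.factorial_ne_zero

theorem rg_rec (k : ℤ) : (k : ℂ) * rg k = rg (k - 1) := by
  rcases k with k | k
  · cases k with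
    | zero =>
      have h : (Int.ofNat 0 - 1 : ℤ) = Int.negSucc 0 := rfl
      rw [h]; simp [rg]
    | succ k =>
      have h : (Int.ofNat (k + 1) - 1 : ℤ) = Int.ofNat k := by simp
      rw [h]
      have := fac_ne k
      have h2 : (k : ℂ) + 1 ≠ 0 := by exact_mod_cast Nat.succ_ne_zero k
      simp [rg, Nat.factorial_succ]
      field_simp
  · have h : (Int.negSucc k - 1 : ℤ) = Int.negSucc (k + 1) := rfl
    rw [h]; simp [rg]

theorem drg_rec (k : ℤ) : (k : ℂ) * drg k + rg k = drg (k - 1) := by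
  rcases k with k | k
  · cases k with
    | zero =>
      have h : (Int.ofNat 0 - 1 : ℤ) = Int.negSucc 0 := rfl
      rw [h]; simp [rg, drg]
    | succ k =>
      have h : (Int.ofNat (k + 1) - 1 : ℤ) = Int.ofNat k := by simp
      rw [h]
      have := fac_ne k
      have h2 : (k : ℂ) + 1 ≠ 0 := by exact_mod_cast Nat.succ_ne_zero k
      simp [rg, drg, Nat.factorial_succ, harmonic_succ]
      field_simp
      ring
  · have h : (Int.negSucc k - 1 : ℤ) = Int.negSucc (k + 1) := rfl
    rw [h]; simp [rg, drg, Nat.factorial_succ]; ring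

theorem fib_rec_aux (x P Q R : ℂ) (hQ : Q ≠ 0) (hR : R ≠ 0) (e1 : x + 1 ≠ 0)
    (e2 : 2 * x + 1 ≠ 0) (e3 : 3 * x + 1 ≠ 0) (e4 : 3 * x + 2 ≠ 0) :
    (x + 1) * ((6 * x + 5 + 1) * ((6 * x + 4 + 1) * ((6 * x + 3 + 1) * ((6 * x + 2 + 1) *
      ((6 * x + 1 + 1) * ((6 * x + 1) * P))))) / (2 * (x + 1) * ((2 * x + 1) * Q) *
      (3 * (x + 1) * ((3 * x + 2) * ((3 * x + 1) * R))))) =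
    12 * (6 * x + 1) * (6 * x + 5) * (P / (Q * R)) := by
  rw [mul_div_assoc', mul_div_assoc', div_eq_div_iff (by simp [*]) (by simp [*])]
  ring

theorem fib_rec (n : ℕ) : ((n : ℂ) + 1) * fib (n + 1) = 12 * (6 * n + 1) * (6 * n + 5) * fib n := by
  have h2 := fac_ne (2 * n)
  have h3 := fac_ne (3 * n)
  have e1 : ((n : ℂ) + 1) ≠ 0 := by exact_mod_cast (by omega : n + 1 ≠ 0)
  have e2 : (2 * (n : ℂ) + 1) ≠ 0 := by exact_mod_cast (by omega : 2 * n + 1 ≠ 0)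
  have e3 : (3 * (n : ℂ) + 1) ≠ 0 := by exact_mod_cast (by omega : 3 * n + 1 ≠ 0)
  have e4 : (3 * (n : ℂ) + 2) ≠ 0 := by exact_mod_cast (by omega : 3 * n + 2 ≠ 0)
  simp only [fib, show 6 * (n + 1) = 6 * n + 5 + 1 by ring, show 2 * (n + 1) = 2 * n + 1 + 1 by ring,
    show 3 * (n + 1) = 3 * n + 2 + 1 by ring, Nat.factorial_succ, Nat.cast_mul, Nat.cast_add,
    Nat.cast_one, Nat.cast_ofNat]
  rw [show (2 * (n : ℂ) + 1 + 1) = 2 * (n + 1) by ring, show (3 * (n : ℂ) + 1 + 1) = 3 * n + 2 by ring,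
    show (3 * (n : ℂ) + 2 + 1) = 3 * (n + 1) by ring]
  exact fib_rec_aux _ _ _ _ h2 h3 e1 e2 e3 e4

theorem har_rec (n : ℕ) : har (n + 1) = har n + 6 / (6 * n + 1) + 6 / (6 * n + 5)
    - 1 / ((n : ℂ) + 1) := by
  have e1 : ((n : ℂ) + 1) ≠ 0 := by exact_mod_cast (by omega : n + 1 ≠ 0)
  have e2 : (2 * (n : ℂ) + 1) ≠ 0 := by exact_mod_cast (by omega : 2 * n + 1 ≠ 0)
  have e3 : (3 * (n : ℂ) + 1) ≠ 0 := by exact_mod_cast (by omega : 3 * n + 1 ≠ 0)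
  have e4 : (3 * (n : ℂ) + 2) ≠ 0 := by exact_mod_cast (by omega : 3 * n + 2 ≠ 0)
  have a2 : (6 * (n : ℂ) + 2) = 2 * (3 * n + 1) := by ring
  have a3 : (6 * (n : ℂ) + 3) = 3 * (2 * n + 1) := by ring
  have a4 : (6 * (n : ℂ) + 4) = 2 * (3 * n + 2) := by ring
  have a6 : (6 * (n : ℂ) + 6) = 6 * (n + 1) := by ring
  have b2 : (2 * (n : ℂ) + 2) = 2 * (n + 1) := by ring
  have b3 : (3 * (n : ℂ) + 3) = 3 * (n + 1) := by ring
  have d1 : (6 * (n : ℂ) + 1) ≠ 0 := by exact_mod_cast (by omega : 6 * n + 1 ≠ 0)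
  have d5 : (6 * (n : ℂ) + 5) ≠ 0 := by exact_mod_cast (by omega : 6 * n + 5 ≠ 0)
  simp only [har, show 6 * (n + 1) = 6 * n + 5 + 1 by ring, show 2 * (n + 1) = 2 * n + 1 + 1 by ring,
    show 3 * (n + 1) = 3 * n + 2 + 1 by ring, harmonic_succ]
  push_cast
  simp only [add_assoc]
  norm_num only
  rw [a2, a3, a4, a6, b2, b3]
  simp only [mul_inv, div_eq_mul_inv]
  ring

theorem periodCoeff_eq (n m : ℕ) :
    periodCoeff n m = fib n * rg (n - 3 * m) / (m.factorial : ℂ) ^ 3 := by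
  have h1 := fac_ne (2 * n)
  have h2 := fac_ne (3 * n)
  have h3 := fac_ne m
  have h4 := fac_ne (n - 3 * m)
  rw [periodCoeff]
  split_ifs with h
  · have : (n - 3 * m : ℤ) = Int.ofNat (n - 3 * m) := by
      simp; omega
    rw [this]; simp only [rg, fib]; field_simp
  · have : (n - 3 * m : ℤ) = Int.negSucc (3 * m - n - 1) := by
      omega
    rw [this]; simp [rg]

theorem logCoeff_eq (n m : ℕ) : logCoeff n m =
    fib n * (rg (n - 3 * m) * har n + drg (n - 3 * m)) / (m.factorial : ℂ) ^ 3 := by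
  have h1 := fac_ne (2 * n)
  have h2 := fac_ne (3 * n)
  have h3 := fac_ne m
  have h4 := fac_ne (n - 3 * m)
  rw [logCoeff, periodCoeff_eq]
  split_ifs with h
  · have : (n - 3 * m : ℤ) = Int.ofNat (n - 3 * m) := by
      simp; omega
    rw [this]; simp only [rg, drg, har]; push_cast; field_simp; ring
  · have : (n - 3 * m : ℤ) = Int.negSucc (3 * m - n - 1) := by
      omega
    rw [this]; simp only [rg, drg, fib]; field_simp; ring

theorem har_fib (n : ℕ) : ((n : ℂ) + 1) * fib (n + 1) * (har (n + 1) - har n) + fib (n + 1)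
    = 12 * (72 * n + 36) * fib n := by
  have e1 : ((n : ℂ) + 1) ≠ 0 := by exact_mod_cast (by omega : n + 1 ≠ 0)
  have d1 : (6 * (n : ℂ) + 1) ≠ 0 := by exact_mod_cast (by omega : 6 * n + 1 ≠ 0)
  have d5 : (6 * (n : ℂ) + 5) ≠ 0 := by exact_mod_cast (by omega : 6 * n + 5 ≠ 0)
  have h := fib_rec n
  have u : 6 / (6 * (n : ℂ) + 1) * (6 * n + 1) = 6 := div_mul_cancel₀ _ d1
  have v : 6 / (6 * (n : ℂ) + 5) * (6 * n + 5) = 6 := div_mul_cancel₀ _ d5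
  have w : 1 / ((n : ℂ) + 1) * (n + 1) = 1 := div_mul_cancel₀ _ e1
  rw [har_rec]
  linear_combination (6 / (6 * (n : ℂ) + 1) + 6 / (6 * (n : ℂ) + 5)) * h
    + 12 * (6 * n + 5) * fib n * u + 12 * (6 * n + 1) * fib n * v - fib (n + 1) * w

theorem rg_shift (n m : ℕ) : rg (n - 3 * (m + 1 : ℕ)) =
    ((n : ℂ) - 3 * m) * (n - 3 * m - 1) * (n - 3 * m - 2) * rg (n - 3 * m) := by
  have h1 := rg_rec (n - 3 * m)
  have h2 := rg_rec (n - 3 * m - 1)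
  have h3 := rg_rec (n - 3 * m - 1 - 1)
  rw [show (n - 3 * (m + 1 : ℕ) : ℤ) = n - 3 * m - 1 - 1 - 1 by push_cast; ring, ← h3, ← h2, ← h1]
  push_cast; ring

theorem drg_shift (n m : ℕ) : drg (n - 3 * (m + 1 : ℕ)) =
    ((n : ℂ) - 3 * m) * (n - 3 * m - 1) * (n - 3 * m - 2) * drg (n - 3 * m)
      + (3 * ((n : ℂ) - 3 * m) ^ 2 - 6 * (n - 3 * m) + 2) * rg (n - 3 * m) := by
  have h1 := rg_rec (n - 3 * m)
  have h2 := rg_rec (n - 3 * m - 1)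
  have g1 := drg_rec (n - 3 * m)
  have g2 := drg_rec (n - 3 * m - 1)
  have g3 := drg_rec (n - 3 * m - 1 - 1)
  rw [show (n - 3 * (m + 1 : ℕ) : ℤ) = n - 3 * m - 1 - 1 - 1 by push_cast; ring, ← g3, ← g2, ← g1,
    ← h2, ← h1]
  push_cast; ring

/-- `X₀` solves the Picard-Fuchs system. -/
theorem L₁_X₀ : L₁ (0, X₀) = 0 := by
  refine Prod.ext (ser_ext fun n m => ?_) (ser_ext fun n m => ?_) <;> cases n with
  | zero => simp [coeff_L₁_fst_zero, coeff_L₁_snd_zero]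
  | succ n =>
    simp only [coeff_L₁_fst_succ, coeff_L₁_snd_succ, coeff_X₀, periodCoeff_eq, Prod.fst_zero,
      Prod.snd_zero, map_zero, mul_zero, add_zero, sub_zero]
    try
      have h := rg_rec ((n + 1 : ℕ) - 3 * m)
      have h' := fib_rec n
      rw [show ((n + 1 : ℕ) - 3 * m - 1 : ℤ) = n - 3 * m by push_cast; ring] at h
      rw [← h]
      push_cast
      have := fac_ne m
      field_simp
      push_cast at *
      linear_combination ((n : ℂ) + 1 - 3 * m) * rg (n + 1 - 3 * m) * h'

theorem L₂_X₀ : L₂ (0, X₀) = 0 := by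
  refine Prod.ext (ser_ext fun n m => ?_) (ser_ext fun n m => ?_) <;> cases m with
  | zero => simp [coeff_L₂_fst_zero, coeff_L₂_snd_zero]
  | succ m =>
    simp only [coeff_L₂_fst_succ, coeff_L₂_snd_succ, coeff_X₀, periodCoeff_eq, Prod.fst_zero,
      Prod.snd_zero, map_zero, mul_zero, add_zero, sub_zero]
    try
      rw [rg_shift, Nat.factorial_succ]
      have := fac_ne m
      have h2 : (m : ℂ) + 1 ≠ 0 := by exact_mod_cast Nat.succ_ne_zero m
      push_cast
      field_simp
      ring

/-- `X₀ log z₁ + S` solves the Picard-Fuchs system. -/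
theorem L₁_X₁ : L₁ (X₀, S) = 0 := by
  refine Prod.ext (ser_ext fun n m => ?_) (ser_ext fun n m => ?_)
  · cases n with
    | zero => simp [coeff_L₁_fst_zero]
    | succ n =>
      have := congrArg (fun w : LogSer => coeff (ex (n + 1) m) w.2) L₁_X₀
      simp only [coeff_L₁_fst_succ, coeff_L₁_snd_succ] at this ⊢
      simpa [mul_assoc] using this
  · cases n with
    | zero =>
      rw [coeff_L₁_snd_zero, coeff_X₀]
      cases m <;> simp [periodCoeff]
    | succ n =>
      rw [coeff_L₁_snd_succ, coeff_X₀, coeff_X₀, coeff_S, coeff_S]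
      simp only [periodCoeff_eq, logCoeff_eq, Prod.snd_zero, map_zero]
      have h := rg_rec ((n + 1 : ℕ) - 3 * m)
      have g := drg_rec ((n + 1 : ℕ) - 3 * m)
      have h' := fib_rec n
      have k := har_fib n
      rw [show ((n + 1 : ℕ) - 3 * m - 1 : ℤ) = n - 3 * m by push_cast; ring] at h g
      rw [← h, ← g]
      have := fac_ne m
      field_simp
      push_cast at *
      linear_combination (((n : ℂ) + 1 - 3 * m) * rg (n + 1 - 3 * m) * har n
        + ((n : ℂ) + 1 - 3 * m) * drg (n + 1 - 3 * m) + rg (n + 1 - 3 * m)) * h'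
        + ((n : ℂ) + 1 - 3 * m) * rg (n + 1 - 3 * m) * k

theorem L₂_X₁ : L₂ (X₀, S) = 0 := by
  refine Prod.ext (ser_ext fun n m => ?_) (ser_ext fun n m => ?_)
  · cases m with
    | zero => simp [coeff_L₂_fst_zero]
    | succ m =>
      have := congrArg (fun w : LogSer => coeff (ex n (m + 1)) w.2) L₂_X₀
      simp only [coeff_L₂_fst_succ, coeff_L₂_snd_succ] at this ⊢
      simpa using this
  · cases m with
    | zero => simp [coeff_L₂_snd_zero]
    | succ m =>
      rw [coeff_L₂_snd_succ, coeff_X₀, coeff_S, coeff_S]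
      simp only [periodCoeff_eq, logCoeff_eq, Prod.snd_zero, map_zero]
      rw [rg_shift, drg_shift, Nat.factorial_succ]
      have := fac_ne m
      have h2 : (m : ℂ) + 1 ≠ 0 := by exact_mod_cast Nat.succ_ne_zero m
      push_cast
      field_simp
      ring

theorem X₀_const : coeff (ex 0 0) X₀ = 1 := by simp [coeff_X₀, periodCoeff]

theorem S_const : coeff (ex 0 0) S = 0 := by simp [coeff_S, logCoeff]

/-- `X₀` is the only power series solution with constant term `1`. -/
theorem X₀_unique (F : Ser) (h1 : L₁ (0, F) = 0) (h2 : L₂ (0, F) = 0)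
    (h : coeff (ex 0 0) F = 1) : F = X₀ := by
  have := solution_unique ((0, F) - (0, X₀)) (by rw [map_sub, h1, L₁_X₀, sub_zero])
    (by rw [map_sub, h2, L₂_X₀, sub_zero]) (by simp) (by simp [h, X₀_const])
  exact sub_eq_zero.1 (by simpa using congrArg Prod.snd this)

/-- `X₀ log z₁ + S` is the only solution of this shape for which `S` has constant term `0`. -/
theorem S_unique (F : Ser) (h1 : L₁ (X₀, F) = 0) (h2 : L₂ (X₀, F) = 0)
    (h : coeff (ex 0 0) F = 0) : F = S := by
  have := solution_unique ((X₀, F) - (X₀, S)) (by rw [map_sub, h1, L₁_X₁, sub_zero])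
    (by rw [map_sub, h2, L₂_X₁, sub_zero]) (by simp) (by simp [h, S_const])
  exact sub_eq_zero.1 (by simpa using congrArg Prod.snd this)

/-! ### Flat coordinate of the fibre, modular forms of it, and the variable `Z` -/

open UpperHalfPlane in
/-- The `q`-expansion of a function on the upper half plane, `q = exp (2πiτ)`. -/
def qExp (f : ℍ → ℂ) : ℂ⟦X⟧ := qExpansion 1 f

/-- `q_E = exp (X₁ / X₀) = z₁ exp (S / X₀)`. -/
def qE : Ser := z₁ * (PowerSeries.exp ℂ).subst (S * X₀⁻¹)

/-- Substitution of `q = q_E` in a `q`-series. -/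
def atE (φ : ℂ⟦X⟧) : Ser := φ.subst qE

/-- `E₄(q_E)`. -/
def E4 : Ser := atE (qExp ModularForm.E₄)

/-- `η(q_E) ^ 24`. -/
def eta24 : Ser := atE (qExp ModularForm.discriminant)

/-- For a series `F` with constant term `1`, the power `F ^ r = ∑ₖ (r choose k) (F - 1) ^ k`. -/
def ratPow (F : Ser) (r : ℚ) : Ser := (PowerSeries.binomialSeries ℂ r).subst (F - 1)

/-- `Z = z₂ / ((1 - 432 z₁) ^ 3 E₄(q_E) ^ (9/2))`. -/
def Z : Ser := z₂ * ((1 - 432 * z₁) ^ 3 * ratPow E4 (9 / 2))⁻¹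

/-- The series `∑ₙ cₙ(q_E) Z ^ n`. As `z₂ ^ n` divides `Z ^ n`, only the terms with `n ≤ m`
contribute to the coefficient of `z₁ ^ l z₂ ^ m`. -/
def zSeries (c : ℕ → ℂ⟦X⟧) : Ser := fun d =>
  ∑ n ∈ Finset.range (d 1 + 1), coeff d (atE (c n) * Z ^ n)

/-- `F = N * ∑ₙ cₙ(q_E) Z ^ n`, and the coefficients `cₙ` are determined by `F` and `N`. -/
def IsZExpansion (F N : Ser) (c : ℕ → ℂ⟦X⟧) : Prop :=
  F = N * zSeries c ∧ ∀ c' : ℕ → ℂ⟦X⟧, F = N * zSeries c' → c' = c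

/-- `φ` is the `q`-expansion of a (holomorphic) modular form of weight `k` for `SL(2, ℤ)`. -/
def IsModular (k : ℤ) (φ : ℂ⟦X⟧) : Prop := ∃ f : ModularForm 𝒮ℒ k, φ = qExp f

/-- `φ` is `η ^ 24` times a modular form, with total weight `k`. -/
def IsEtaDivisible (k : ℤ) (φ : ℂ⟦X⟧) : Prop :=
  ∃ ψ : ℂ⟦X⟧, IsModular (k - 12) ψ ∧ φ = qExp ModularForm.discriminant * ψ

/-- `(1 - 432 z₁) ^ 3 - 27 z₂ (432 z₁) ^ 3`. -/
def Δ₁ : Ser := (1 - 432 * z₁) ^ 3 - 27 * z₂ * (432 * z₁) ^ 3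

/-- `1 + 27 z₂`. -/
def Δ₂ : Ser := 1 + 27 * z₂

theorem X₀_constantCoeff : constantCoeff X₀ = 1 := by
  have := X₀_const
  rwa [show ex 0 0 = 0 by simp [ex], coeff_zero_eq_constantCoeff_apply] at this

theorem S_constantCoeff : constantCoeff S = 0 := by
  have := S_const
  rwa [show ex 0 0 = 0 by simp [ex], coeff_zero_eq_constantCoeff_apply] at this

/-- The substitution in `qE` is legitimate. -/
theorem hasSubst_log : PowerSeries.HasSubst (S * X₀⁻¹) :=
  PowerSeries.HasSubst.of_constantCoeff_zero (by simp [S_constantCoeff])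

theorem qE_constantCoeff : constantCoeff qE = 0 := by simp [qE, z₁]

/-- The substitution in `atE` is legitimate. -/
theorem hasSubst_qE : PowerSeries.HasSubst qE :=
  PowerSeries.HasSubst.of_constantCoeff_zero qE_constantCoeff

theorem coeff_mul_Z_pow (F : Ser) (n : ℕ) (d : Fin 2 →₀ ℕ) (h : d 1 < n) :
    coeff d (F * Z ^ n) = 0 := by
  refine X_pow_dvd_iff.1 (?_ : (X 1 : Ser) ^ n ∣ F * Z ^ n) d h
  rw [Z, mul_pow]
  exact Dvd.dvd.mul_left (Dvd.intro _ rfl) _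

/-- The substitution in `ratPow E4` is legitimate. -/
theorem hasSubst_E4 : PowerSeries.HasSubst (E4 - 1) := by
  apply PowerSeries.HasSubst.of_constantCoeff_zero
  have h := EisensteinSeries.E_qExpansion_coeff_zero (k := 4) (by norm_num) (by decide)
  have h' : PowerSeries.constantCoeff (qExp ModularForm.E₄ - 1) = 0 := by
    rw [map_sub, map_one, ← PowerSeries.coeff_zero_eq_constantCoeff_apply]
    exact sub_eq_zero.2 h
  have h1 : E4 - 1 = (qExp ModularForm.E₄ - 1).subst qE := by
    rw [PowerSeries.subst_sub hasSubst_qE, ← PowerSeries.coe_substAlgHom hasSubst_qE, map_one,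
      PowerSeries.coe_substAlgHom]; rfl
  rw [h1]
  exact PowerSeries.constantCoeff_subst_eq_zero qE_constantCoeff _ h'

theorem ratPow_add (F : Ser) (h : PowerSeries.HasSubst (F - 1)) (r s : ℚ) :
    ratPow F (r + s) = ratPow F r * ratPow F s := by
  rw [ratPow, PowerSeries.binomialSeries_add, PowerSeries.subst_mul h]; rfl

theorem ratPow_one (F : Ser) (h : PowerSeries.HasSubst (F - 1)) : ratPow F 1 = F := by
  have h1 := PowerSeries.binomialSeries_nat (R := ℚ) (A := ℂ) 1
  rw [Nat.cast_one] at h1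
  rw [ratPow, h1, pow_one, PowerSeries.subst_add h, PowerSeries.subst_X h,
    ← PowerSeries.coe_substAlgHom h, map_one]
  ring

end X18

end

open X18

/-!
Write `s = 1 - 864 z₁` and `y = z₂ / (1 - 432 z₁) ^ 3`. By the Picard–Fuchs equations `X₀` and `X₁`
are combinations of their values on `z₂ = 0`, which are periods of an elliptic curve, and of the
derivatives of these, with coefficients `∑ pₘ(s) yᵐ` in which `pₘ` is a polynomial in `s` whose
degree and parity are controlled by `m`.
Ramanujan's differential equations, read along `z₂`, then show that `E₄(q_E)`, `E₆(q_E)` and `X₀`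
have the same shape once divided by powers of a factor `W⁻¹` of weight one; the inhomogeneous
behaviour of `E₂` is absorbed by the second elliptic period. On `z₂ = 0` one has
`s = E₆ / E₄ ^ (3 / 2)`. Any series `∑ pₘ(s) yᵐ` therefore expands in powers of `Z`: replace `s` in
its leading coefficient by `E₆(q_E) / E₄(q_E) ^ (3 / 2)`, which gives a modular form, divide the
remainder by `Z`, and repeat. Reduction modulo `z₁` computes the constant terms of the coefficients,
and a modular form without constant term is divisible by `η ^ 24`.
-/

noncomputable section

namespace X18

/-! ### Ramanujan's differential equations for `q`-series -/

section QSeries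

open UpperHalfPlane hiding I
open Complex ModularForm Function.Periodic
open scoped Manifold Topology Derivative

/-- The derivation `q d/dq` of `q`-series. -/
def qD : Derivation ℂ ℂ⟦X⟧ ℂ⟦X⟧ := (PowerSeries.X : ℂ⟦X⟧) • PowerSeries.derivative ℂ

theorem qD_apply (φ : ℂ⟦X⟧) : qD φ = PowerSeries.X * PowerSeries.derivative ℂ φ := rfl

theorem coeff_qD (φ : ℂ⟦X⟧) (m : ℕ) :
    PowerSeries.coeff m (qD φ) = m * PowerSeries.coeff m φ := by
  cases m with
  | zero => simp [qD_apply]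
  | succ m =>
    rw [qD_apply, PowerSeries.coeff_succ_X_mul, PowerSeries.coeff_derivative, mul_comm]
    push_cast
    rfl

theorem constantCoeff_qD (φ : ℂ⟦X⟧) : PowerSeries.constantCoeff (qD φ) = 0 := by simp [qD_apply]

/-- The function `F` on the upper half plane is everywhere the sum of the `q`-series `φ`. -/
def HasQSeries (F : ℍ → ℂ) (φ : ℂ⟦X⟧) : Prop :=
  ∀ τ : ℍ, HasSum (fun m : ℕ => PowerSeries.coeff m φ • qParam 1 (τ : ℂ) ^ m) (F τ)

namespace HasQSeries

variable {F G : ℍ → ℂ} {φ ψ : ℂ⟦X⟧}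

theorem sub (hF : HasQSeries F φ) (hG : HasQSeries G ψ) : HasQSeries (F - G) (φ - ψ) := fun τ => by
  simpa [sub_smul, sub_mul] using (hF τ).sub (hG τ)

theorem smul (c : ℂ) (hF : HasQSeries F φ) : HasQSeries (c • F) (c • φ) := fun τ => by
  simpa [mul_assoc] using (hF τ).mul_left c

theorem mul (hF : HasQSeries F φ) (hG : HasQSeries G ψ) : HasQSeries (F * G) (φ * ψ) := fun τ => by
  have hF' := (hF τ).summable.norm
  have hG' := (hG τ).summable.norm
  have h := (summable_norm_sum_mul_antidiagonal_of_summable_norm hF' hG').of_norm.hasSum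
  rw [← tsum_mul_tsum_eq_tsum_sum_antidiagonal_of_summable_norm hF' hG', (hF τ).tsum_eq,
    (hG τ).tsum_eq] at h
  refine h.congr_fun fun m => ?_
  rw [PowerSeries.coeff_mul, Finset.sum_smul]
  refine Finset.sum_congr rfl fun i hi => ?_
  rw [← Finset.HasAntidiagonal.mem_antidiagonal.1 hi, pow_add]
  simp only [smul_eq_mul]
  ring

end HasQSeries

theorem hasDerivAt_qParam_one_pow (m : ℕ) (w : ℂ) :
    HasDerivAt (fun w : ℂ => qParam 1 w ^ m) (2 * Real.pi * I * (m * qParam 1 w ^ m)) w := by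
  have hexp (z : ℂ) : qParam 1 z ^ m = exp (m * (2 * Real.pi * I * z)) := by
    rw [qParam, ← Complex.exp_nat_mul]
    simp
  simp only [hexp]
  refine ((((hasDerivAt_id w).const_mul (2 * Real.pi * I)).const_mul (m : ℂ)).cexp).congr_deriv ?_
  simp only [id_eq]
  ring

theorem norm_qParam_one_le {z w : ℂ} (h : z.im ≤ w.im) : ‖qParam 1 w‖ ≤ ‖qParam 1 z‖ := by
  rw [norm_qParam, norm_qParam, Real.exp_le_exp, div_one, div_one]
  nlinarith [Real.pi_pos]

theorem HasQSeries.hasSum_deriv {F : ℍ → ℂ} {φ : ℂ⟦X⟧} (hF : HasQSeries F φ) (τ : ℍ) :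
    HasSum (fun m : ℕ => 2 * Real.pi * I * (PowerSeries.coeff m (qD φ) • qParam 1 (τ : ℂ) ^ m))
      (deriv (F ∘ ofComplex) (τ : ℂ)) := by
  set U : Set ℂ := {w | τ.im / 2 < w.im}
  have hU : IsOpen U := isOpen_lt continuous_const Complex.continuous_im
  have hτU : (τ : ℂ) ∈ U := half_lt_self τ.im_pos
  have hpos : ∀ w ∈ U, 0 < w.im := fun w hw => (half_pos τ.im_pos).trans hw
  let σ : ℍ := ⟨(τ.im / 2 : ℝ) * I, by simpa using τ.im_pos⟩
  have hderiv (m : ℕ) (w : ℂ) : HasDerivAt (fun w : ℂ => PowerSeries.coeff m φ • qParam 1 w ^ m)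
      (2 * Real.pi * I * (PowerSeries.coeff m (qD φ) • qParam 1 w ^ m)) w := by
    refine ((hasDerivAt_qParam_one_pow m w).const_smul (PowerSeries.coeff m φ)).congr_deriv ?_
    rw [coeff_qD]
    simp only [smul_eq_mul]
    ring
  have hbound (m : ℕ) (w : ℂ) (hw : w ∈ U) : ‖PowerSeries.coeff m φ • qParam 1 w ^ m‖ ≤
      ‖PowerSeries.coeff m φ • qParam 1 (σ : ℂ) ^ m‖ := by
    have hσw : (σ : ℂ).im ≤ w.im := by simpa [σ] using hw.le
    rw [norm_smul, norm_smul, norm_pow, norm_pow]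
    gcongr
    exact norm_qParam_one_le hσw
  have key := Complex.hasSum_deriv_of_summable_norm (hF σ).summable.norm
    (fun m w _ => (hderiv m w).differentiableAt.differentiableWithinAt) hU hbound hτU
  have hsum : (fun w => ∑' m : ℕ, PowerSeries.coeff m φ • qParam 1 w ^ m) =ᶠ[𝓝 (τ : ℂ)]
      F ∘ ofComplex := by
    filter_upwards [hU.mem_nhds hτU] with w hw
    rw [Function.comp_apply, ofComplex_apply_of_im_pos (hpos w hw)]
    exact (hF ⟨w, hpos w hw⟩).tsum_eq
  rw [hsum.deriv_eq] at key
  exact key.congr_fun fun m => (hderiv m τ).deriv.symm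

theorem HasQSeries.normalizedDeriv {F : ℍ → ℂ} {φ : ℂ⟦X⟧} (hF : HasQSeries F φ) :
    HasQSeries (D F) (qD φ) := fun τ =>
  ((hF.hasSum_deriv τ).mul_left (2 * Real.pi * I)⁻¹).congr_fun fun _ =>
    (inv_mul_cancel_left₀ (by simp [Real.pi_ne_zero]) _).symm

theorem HasQSeries.isModular {F : ℍ → ℂ} {φ : ℂ⟦X⟧} (hF : HasQSeries F φ) (hd : MDiff F) {k : ℤ}
    (hslash : ∀ γ : SL(2, ℤ), F ∣[k] γ = F) : IsModular k φ := by
  let f : ModularForm 𝒮ℒ k :=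
    { toFun := F
      slash_action_eq' := fun _ ⟨γ, hγ⟩ => hγ ▸ hslash γ
      holo' := hd
      bdd_at_cusps' := fun {c} hc => by
        rw [Subgroup.IsArithmetic.isCusp_iff_isCusp_SL2Z] at hc
        rw [OnePoint.isBoundedAt_iff_forall_SL2Z hc]
        intro γ _
        rw [hslash γ]
        exact isBoundedAtImInfty_of_hasSum_qExpansion one_pos hF }
  refine ⟨f, PowerSeries.ext fun m => ?_⟩
  exact ModularFormClass.qExpansion_coeff_unique (f := f) one_pos one_mem_strictPeriods_SL hF m

theorem hasQSeries_modularForm {k : ℤ} (f : ModularForm 𝒮ℒ k) : HasQSeries f (qExp f) := fun τ => by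
  have : Fact (IsCusp OnePoint.infty 𝒮ℒ) :=
    ⟨Subgroup.isCusp_of_mem_strictPeriods one_pos one_mem_strictPeriods_SL⟩
  exact ModularForm.hasSum_qExpansion f one_pos one_mem_strictPeriods_SL τ

theorem modularForm_slash_SL {k : ℤ} (f : ModularForm 𝒮ℒ k) (γ : SL(2, ℤ)) : (⇑f) ∣[k] γ = f := by
  rw [ModularForm.SL_slash]
  exact f.slash_action_eq' _ ⟨γ, rfl⟩

namespace IsModular

variable {k l : ℤ} {φ ψ : ℂ⟦X⟧}

theorem mul (hφ : IsModular k φ) (hψ : IsModular l ψ) : IsModular (k + l) (φ * ψ) := by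
  obtain ⟨f, rfl⟩ := hφ
  obtain ⟨g, rfl⟩ := hψ
  exact ⟨f.mul g, (ModularForm.qExpansion_mul one_pos one_mem_strictPeriods_SL f g).symm⟩

theorem pow (hφ : IsModular k φ) (n : ℕ) : IsModular (n * k) (φ ^ n) := by
  obtain ⟨f, rfl⟩ := hφ
  exact ⟨f.pow n, (ModularForm.qExpansion_pow one_pos one_mem_strictPeriods_SL f n).symm⟩

theorem add (hφ : IsModular k φ) (hψ : IsModular k ψ) : IsModular k (φ + ψ) := by
  obtain ⟨f, rfl⟩ := hφ
  obtain ⟨g, rfl⟩ := hψ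
  exact ⟨f + g, (ModularForm.qExpansion_add one_pos one_mem_strictPeriods_SL f g).symm⟩

theorem smul (c : ℂ) (hφ : IsModular k φ) : IsModular k (c • φ) := by
  obtain ⟨f, rfl⟩ := hφ
  exact ⟨c • f, (ModularForm.qExpansion_smul one_pos one_mem_strictPeriods_SL c f).symm⟩

theorem eq_of_constantCoeff_eq {k : ℕ} (hk : k < 12) (hφ : IsModular k φ) (hψ : IsModular k ψ)
    (h : PowerSeries.constantCoeff φ = PowerSeries.constantCoeff ψ) : φ = ψ := by
  obtain ⟨f, rfl⟩ := hφ
  obtain ⟨g, rfl⟩ := hψ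
  have hsub : qExp ⇑(f - g) = qExp f - qExp g :=
    ModularForm.qExpansion_sub one_pos one_mem_strictPeriods_SL f g
  have hfg : f - g = 0 := by
    refine ModularForm.sturm_bound_levelOne_nat ?_
    rw [Nat.div_eq_of_lt hk, Nat.cast_zero, pos_iff_ne_zero,
      PowerSeries.order_ne_zero_iff_constCoeff_eq_zero, ← qExp, hsub]
    simpa [sub_eq_zero] using h
  rw [sub_eq_zero.1 hfg]

theorem isEtaDivisible (hφ : IsModular k φ) (h : PowerSeries.constantCoeff φ = 0) :
    IsEtaDivisible k φ := by
  obtain ⟨f, rfl⟩ := hφ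
  rw [← PowerSeries.coeff_zero_eq_constantCoeff_apply] at h
  exact ⟨_, ⟨_, rfl⟩, ModularForm.qExpansion_eq_qExpansion_discriminant_mul f h⟩

end IsModular

theorem isModular_zero (k : ℤ) : IsModular k 0 :=
  ⟨0, (UpperHalfPlane.qExpansion_zero 1).symm⟩

/-- The `q`-series of the Eisenstein series `E₂`, normalised to have constant term `1`. -/
def e2 : ℂ⟦X⟧ :=
  PowerSeries.mk fun m => if m = 0 then 1 else -24 * (ArithmeticFunction.sigma 1 m : ℂ)

theorem hasQSeries_E2 : HasQSeries EisensteinSeries.E2 e2 := fun τ => by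
  simpa only [e2, PowerSeries.coeff_mk, qParam, ofReal_one, div_one] using
    EisensteinSeries.hasSum_qExpansion_E2 (z := τ)

/-- The `q`-series of the Eisenstein series `E₄`. -/
abbrev e4 : ℂ⟦X⟧ := qExp ModularForm.E₄

/-- The `q`-series of the Eisenstein series `E₆`. -/
abbrev e6 : ℂ⟦X⟧ := qExp ModularForm.E₆

theorem isModular_e4 : IsModular 4 e4 := ⟨ModularForm.E₄, rfl⟩

theorem isModular_e6 : IsModular 6 e6 := ⟨ModularForm.E₆, rfl⟩

theorem constantCoeff_e2 : PowerSeries.constantCoeff e2 = 1 := by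
  simp [e2, ← PowerSeries.coeff_zero_eq_constantCoeff_apply]

theorem constantCoeff_e4 : PowerSeries.constantCoeff e4 = 1 := by
  rw [← PowerSeries.coeff_zero_eq_constantCoeff_apply]
  exact EisensteinSeries.E_qExpansion_coeff_zero (k := 4) (by norm_num) (by decide)

theorem constantCoeff_e6 : PowerSeries.constantCoeff e6 = 1 := by
  rw [← PowerSeries.coeff_zero_eq_constantCoeff_apply]
  exact EisensteinSeries.E_qExpansion_coeff_zero (k := 6) (by norm_num) (by decide)

theorem IsModular.serreDerivative {k : ℤ} {φ : ℂ⟦X⟧} (hφ : IsModular k φ) :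
    IsModular (k + 2) (qD φ - (k / 12 : ℂ) • (e2 * φ)) := by
  obtain ⟨f, rfl⟩ := hφ
  have hf := hasQSeries_modularForm f
  have hserre : HasQSeries (Derivative.serreDerivative k f)
      (qD (qExp f) - (k / 12 : ℂ) • (e2 * qExp f)) := by
    convert hf.normalizedDeriv.sub ((hasQSeries_E2.mul hf).smul (k / 12 : ℂ)) using 1
    ext z
    simp [div_eq_mul_inv, mul_assoc]
  exact hserre.isModular (Derivative.serreDerivative_mdifferentiable _ f.holo')
    fun γ => Derivative.serreDerivative_slash_invariant f.holo' (modularForm_slash_SL f γ)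

theorem E2_slash_SL (γ : SL(2, ℤ)) : EisensteinSeries.E2 ∣[(2 : ℤ)] γ = fun w : ℍ =>
    EisensteinSeries.E2 w + 12 * (2 * Real.pi * I)⁻¹ * ((γ 1 0 : ℂ) / denom γ w) := by
  rw [EisensteinSeries.E2_slash_action]
  ext w
  have hdenom := denom_ne_zero γ w
  have hpi : (Real.pi : ℂ) ≠ 0 := by simp [Real.pi_ne_zero]
  simp only [Pi.sub_apply, Pi.smul_apply, smul_eq_mul, EisensteinSeries.D2, riemannZeta_two]
  field_simp
  linear_combination (-12 * (γ 1 0 : ℂ)) * I_sq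

theorem normalizedDeriv_E2_slash_SL (γ : SL(2, ℤ)) (z : ℍ) :
    D (EisensteinSeries.E2 ∣[(2 : ℤ)] γ) z = D EisensteinSeries.E2 z
      - 12 * (2 * Real.pi * I : ℂ)⁻¹ ^ 2 * ((γ 1 0 : ℂ) / denom γ z) ^ 2 := by
  set p : ℂ := (2 * Real.pi * I)⁻¹
  have hE2 := (mdifferentiableAt_iff.mp (E2_mdifferentiable z)).hasDerivAt
  have hdenom := (hasDerivAt_denom_zpow γ (-1) z).const_mul (12 * p * (γ 1 0 : ℂ))
  have hslash : (EisensteinSeries.E2 ∣[(2 : ℤ)] γ) ∘ ofComplex =ᶠ[𝓝 (z : ℂ)] fun w =>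
      (EisensteinSeries.E2 ∘ ofComplex) w + 12 * p * (γ 1 0 : ℂ) * denom γ w ^ (-1 : ℤ) := by
    filter_upwards [isOpen_upperHalfPlaneSet.mem_nhds z.im_pos] with w hw
    rw [E2_slash_SL]
    simp only [Function.comp_apply, ofComplex_apply_of_im_pos hw, zpow_neg_one]
    ring
  have hγ : ((γ : GL (Fin 2) ℝ) 1 0 : ℂ) = (γ 1 0 : ℂ) := by simp
  simp only [Derivative.normalizedDerivOfComplex]
  rw [hslash.deriv_eq]
  refine (congrArg (p * ·) (hE2.add hdenom).deriv).trans ?_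
  rw [hγ, show (-1 - 1 : ℤ) = -2 by norm_num, zpow_neg]
  push_cast
  rw [div_pow, zpow_two]
  ring

/-- The factor is `1/12` instead of the `2/12` of a Serre derivative in weight two because `E₂` is
only quasimodular. -/
theorem serreDerivative_E2_slash_SL (γ : SL(2, ℤ)) :
    (D EisensteinSeries.E2 - (12⁻¹ : ℂ) • (EisensteinSeries.E2 * EisensteinSeries.E2)) ∣[(4 : ℤ)] γ
      = D EisensteinSeries.E2 - (12⁻¹ : ℂ) • (EisensteinSeries.E2 * EisensteinSeries.E2) := by
  ext z
  have hD := congrFun (Derivative.normalizedDerivOfComplex_SL_slash (k := 2) (γ := γ)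
    E2_mdifferentiable) z
  have hmul := congrFun
    (ModularForm.mul_slash_SL2 2 2 γ EisensteinSeries.E2 EisensteinSeries.E2) z
  rw [normalizedDeriv_E2_slash_SL] at hD
  rw [E2_slash_SL] at hmul hD
  rw [show (2 + 2 : ℤ) = 4 by norm_num] at hmul hD
  rw [ModularForm.SL_slash_apply] at hmul ⊢
  simp only [Pi.sub_apply, Pi.mul_apply, Pi.smul_apply, smul_eq_mul] at hD hmul ⊢
  rw [ModularForm.SL_slash_apply] at hD
  push_cast at hD
  linear_combination -hD - 12⁻¹ * hmul

theorem isModular_serreDerivative_e2 : IsModular 4 (qD e2 - (12⁻¹ : ℂ) • (e2 * e2)) :=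
  (hasQSeries_E2.normalizedDeriv.sub ((hasQSeries_E2.mul hasQSeries_E2).smul 12⁻¹)).isModular
    ((Derivative.normalizedDerivOfComplex_mdifferentiable E2_mdifferentiable).sub
      ((E2_mdifferentiable.mul E2_mdifferentiable).const_smul _))
    serreDerivative_E2_slash_SL

theorem qD_e2 : qD e2 = (12⁻¹ : ℂ) • (e2 ^ 2 - e4) := by
  have h : qD e2 - (12⁻¹ : ℂ) • (e2 * e2) = (-12⁻¹ : ℂ) • e4 := by
    refine IsModular.eq_of_constantCoeff_eq (k := 4) (by norm_num) isModular_serreDerivative_e2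
      (isModular_e4.smul _) ?_
    simp [constantCoeff_qD, constantCoeff_e2, constantCoeff_e4]
  rw [sub_eq_iff_eq_add.1 h, pow_two]
  module

theorem qD_e4 : qD e4 = (3⁻¹ : ℂ) • (e2 * e4 - e6) := by
  have h : qD e4 - ((4 : ℤ) / 12 : ℂ) • (e2 * e4) = (-3⁻¹ : ℂ) • e6 := by
    refine IsModular.eq_of_constantCoeff_eq (k := 6) (by norm_num) isModular_e4.serreDerivative
      (isModular_e6.smul _) ?_
    norm_num [constantCoeff_qD, constantCoeff_e2, constantCoeff_e4, constantCoeff_e6]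
  rw [sub_eq_iff_eq_add.1 h]
  push_cast
  module

theorem qD_e6 : qD e6 = (2⁻¹ : ℂ) • (e2 * e6 - e4 ^ 2) := by
  have h : qD e6 - ((6 : ℤ) / 12 : ℂ) • (e2 * e6) = (-2⁻¹ : ℂ) • e4 ^ 2 := by
    refine IsModular.eq_of_constantCoeff_eq (k := 8) (by norm_num) isModular_e6.serreDerivative
      ((isModular_e4.pow 2).smul _) ?_
    norm_num [constantCoeff_qD, constantCoeff_e2, constantCoeff_e4, constantCoeff_e6]
  rw [sub_eq_iff_eq_add.1 h]
  push_cast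
  module

theorem qExp_discriminant :
    (1728 : ℂ) • qExp ModularForm.discriminant = e4 ^ 3 - e6 ^ 2 := by
  have hΔ : (1728 : ℂ) • ⇑CuspForm.discriminant =
      ⇑(ModularForm.E₄.pow 3) - ⇑(ModularForm.E₆.pow 2) := by
    ext z
    simp only [CuspForm.coe_discriminant, Pi.smul_apply, Pi.sub_apply, smul_eq_mul,
      ModularForm.coe_pow, Pi.pow_apply, ModularForm.discriminant_eq_E₄_cube_sub_E₆_sq z]
    ring
  simp only [e4, e6, qExp]
  rw [← CuspForm.coe_discriminant,
    ← ModularForm.qExpansion_smul one_pos one_mem_strictPeriods_SL, hΔ,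
    ModularForm.qExpansion_sub one_pos one_mem_strictPeriods_SL,
    ModularForm.qExpansion_pow one_pos one_mem_strictPeriods_SL,
    ModularForm.qExpansion_pow one_pos one_mem_strictPeriods_SL]

end QSeries

/-! ### Columns of a power series in two variables -/

section Columns

open MvPowerSeries

theorem eq_ex (d : Fin 2 →₀ ℕ) : d = ex (d 0) (d 1) := by
  ext i; fin_cases i <;> simp [ex]

/-- The indexing of the variables that makes `z₂` the distinguished one. -/
def finTwoEquivOptionUnit : Fin 2 ≃ Option Unit where
  toFun := ![some (), none]
  invFun o := o.elim 1 fun _ => 0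
  left_inv i := by fin_cases i <;> rfl
  right_inv o := by rcases o with _ | ⟨⟩ <;> rfl

/-- A series in `z₁` and `z₂` viewed as a series in `z₂` whose coefficients are series in `z₁`. -/
def columns : Ser ≃ₐ[ℂ] ℂ⟦X⟧⟦X⟧ :=
  (renameEquiv ℂ finTwoEquivOptionUnit).trans (optionEquivLeft Unit ℂ)

theorem coeff_coeff_columns (n m : ℕ) (F : Ser) :
    PowerSeries.coeff n (PowerSeries.coeff m (columns F)) = coeff (ex n m) F := by
  have hd : (Finsupp.single () n).optionElim m =
      (ex n m).embDomain finTwoEquivOptionUnit.toEmbedding := by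
    ext o
    obtain ⟨i, rfl⟩ := finTwoEquivOptionUnit.surjective o
    refine Eq.trans ?_ (Finsupp.embDomain_apply_self _ _ i).symm
    fin_cases i
    · simp [finTwoEquivOptionUnit, ex_zero]
    · simp [finTwoEquivOptionUnit, ex_one]
  rw [PowerSeries.coeff_def (s := Finsupp.single () n) (Finsupp.single_eq_same ..)]
  have hF : columns F = optionEquivLeft Unit ℂ (rename finTwoEquivOptionUnit.toEmbedding F) := rfl
  rw [hF, coeff_coeff_optionEquivLeft, hd, coeff_embDomain_rename]

/-- The coefficient of `z₂ ^ m`, a power series in `z₁`. -/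
def col (m : ℕ) : Ser →ₗ[ℂ] ℂ⟦X⟧ :=
  (PowerSeries.coeff m).restrictScalars ℂ ∘ₗ columns.toLinearMap

@[simp]
theorem coeff_col (n m : ℕ) (F : Ser) : PowerSeries.coeff n (col m F) = coeff (ex n m) F :=
  coeff_coeff_columns n m F

theorem col_ext {F G : Ser} (h : ∀ m, col m F = col m G) : F = G :=
  columns.injective (PowerSeries.ext h)

/-- The series with given columns. -/
def ofCol (c : ℕ → ℂ⟦X⟧) : Ser := columns.symm (PowerSeries.mk c)

@[simp]
theorem col_ofCol (c : ℕ → ℂ⟦X⟧) (m : ℕ) : col m (ofCol c) = c m := by simp [col, ofCol]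

theorem col_mul (m : ℕ) (F G : Ser) :
    col m (F * G) = ∑ p ∈ Finset.HasAntidiagonal.antidiagonal m, col p.1 F * col p.2 G := by
  simp [col, PowerSeries.coeff_mul]

theorem col_zero_mul (F G : Ser) : col 0 (F * G) = col 0 F * col 0 G := by simp [col_mul]

theorem col_one (m : ℕ) : col m 1 = if m = 0 then 1 else 0 := by
  simp [col, PowerSeries.coeff_one]

/-- Setting `z₂ = 0`. -/
def col₀ : Ser →ₐ[ℂ] ℂ⟦X⟧ :=
  AlgHom.ofLinearMap (col 0) (by simp [col_one]) col_zero_mul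

theorem col₀_apply (F : Ser) : col₀ F = col 0 F := rfl

theorem constantCoeff_col_zero (F : Ser) :
    PowerSeries.constantCoeff (col 0 F) = constantCoeff F := by
  rw [← PowerSeries.coeff_zero_eq_constantCoeff_apply, coeff_col,
    ← coeff_zero_eq_constantCoeff_apply]
  simp [ex]

/-- The inclusion of the power series in `z₁` alone. -/
def inc : ℂ⟦X⟧ →ₐ[ℂ] Ser :=
  columns.symm.toAlgHom.comp
    { PowerSeries.C with
      commutes' := fun _ => (algebraMap_apply (σ := Unit) (A := ℂ⟦X⟧)).symm }

theorem columns_inc (φ : ℂ⟦X⟧) : columns (inc φ) = PowerSeries.C φ :=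
  columns.apply_symm_apply (PowerSeries.C φ)

theorem col_inc_mul (m : ℕ) (φ : ℂ⟦X⟧) (F : Ser) : col m (inc φ * F) = φ * col m F := by
  simp [col, columns_inc]

theorem col_inc (m : ℕ) (φ : ℂ⟦X⟧) : col m (inc φ) = if m = 0 then φ else 0 := by
  simp [col, columns_inc, PowerSeries.coeff_C]

theorem columns_z₁ : columns z₁ = PowerSeries.C PowerSeries.X := by
  simp [columns, z₁, finTwoEquivOptionUnit, renameEquiv, PowerSeries.X]

theorem columns_z₂ : columns z₂ = PowerSeries.X := by
  simp [columns, z₂, finTwoEquivOptionUnit, renameEquiv]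

theorem inc_X : inc PowerSeries.X = z₁ :=
  columns.injective (by rw [columns_inc, columns_z₁])

theorem col_z₂_mul_zero (F : Ser) : col 0 (z₂ * F) = 0 := by
  simp [col, columns_z₂]

theorem col_z₂_mul_succ (m : ℕ) (F : Ser) : col (m + 1) (z₂ * F) = col m F := by
  simp [col, columns_z₂, PowerSeries.coeff_succ_X_mul]

theorem z₂_pow_dvd_iff (M : ℕ) (F : Ser) : z₂ ^ M ∣ F ↔ ∀ m < M, col m F = 0 := by
  rw [← map_dvd_iff columns, map_pow, columns_z₂]
  exact PowerSeries.X_pow_dvd_iff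

end Columns

/-! ### Derivations and the chain rule -/

section ChainRule

open MvPowerSeries

theorem eq_of_forall_pow_dvd {σ R : Type*} [CommRing R] {F G A : MvPowerSeries σ R}
    (hA : constantCoeff A = 0) (h : ∀ M, A ^ M ∣ F - G) : F = G := by
  rw [← sub_eq_zero]
  ext d
  obtain ⟨H, hH⟩ := h (d.degree + 1)
  refine (coeff_of_lt_order ?_).trans (map_zero _).symm
  rw [hH]
  calc (d.degree : ℕ∞) < (d.degree + 1 : ℕ) := by exact_mod_cast Nat.lt_succ_self _
    _ ≤ (A ^ (d.degree + 1)).order := le_order_pow_of_constantCoeff_eq_zero _ hA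
    _ ≤ (A ^ (d.degree + 1)).order + H.order := le_self_add
    _ ≤ (A ^ (d.degree + 1) * H).order := le_order_mul

theorem map_subst_of_map_eq_zero {σ R S F : Type*} [CommRing R] [CommRing S] {A : MvPowerSeries σ R}
    (hA : constantCoeff A = 0) [FunLike F (MvPowerSeries σ R) S]
    [RingHomClass F (MvPowerSeries σ R) S] (f : F) (hf : f A = 0) (φ : R⟦X⟧) :
    f (φ.subst A) = f (C (PowerSeries.constantCoeff φ)) := by
  have hs := PowerSeries.HasSubst.of_constantCoeff_zero hA
  conv_lhs => rw [PowerSeries.eq_X_mul_shift_add_const φ, ← PowerSeries.algebraMap_eq,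
    ← PowerSeries.coe_substAlgHom hs, map_add, map_mul, AlgHom.commutes,
    PowerSeries.substAlgHom_X, map_add, map_mul, hf, zero_mul, zero_add]
  rfl

theorem constantCoeff_subst_of_constantCoeff_eq_zero {σ R : Type*} [CommRing R]
    {A : MvPowerSeries σ R} (hA : constantCoeff A = 0) (φ : R⟦X⟧) :
    constantCoeff (φ.subst A) = PowerSeries.constantCoeff φ := by
  rw [map_subst_of_map_eq_zero hA _ hA, constantCoeff_C]

theorem derivation_subst {σ R : Type*} [CommRing R]
    (D : Derivation R (MvPowerSeries σ R) (MvPowerSeries σ R)) {A : MvPowerSeries σ R}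
    (hA : constantCoeff A = 0) (φ : R⟦X⟧) :
    D (φ.subst A) = (PowerSeries.derivative R φ).subst A * D A := by
  have hs := PowerSeries.HasSubst.of_constantCoeff_zero hA
  refine eq_of_forall_pow_dvd hA fun M => ?_
  set p := φ.trunc (M + 1)
  obtain ⟨ψ, hφ⟩ : ∃ ψ, φ = (p : R⟦X⟧) + PowerSeries.X ^ (M + 1) * ψ :=
    ⟨_, (PowerSeries.eq_X_pow_mul_shift_add_trunc (M + 1) φ).trans (add_comm _ _)⟩
  have hp : D ((p : R⟦X⟧).subst A) = (PowerSeries.derivative R (p : R⟦X⟧)).subst A * D A := by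
    rw [PowerSeries.subst_coe hs, PowerSeries.derivative_coe, PowerSeries.subst_coe hs,
      Derivation.comp_aeval_eq, smul_eq_mul]
  have hX : PowerSeries.substAlgHom hs (PowerSeries.X : R⟦X⟧) = A := by
    rw [PowerSeries.coe_substAlgHom, PowerSeries.subst_X hs]
  rw [← PowerSeries.coe_substAlgHom hs] at hp ⊢
  set s := PowerSeries.substAlgHom (R := R) hs
  refine ⟨((M + 1 : ℕ) : MvPowerSeries σ R) * D A * s ψ + A * D (s ψ)
    - (A * s (PowerSeries.derivative R ψ) + s ψ * ((M + 1 : ℕ) : MvPowerSeries σ R)) * D A, ?_⟩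
  rw [hφ]
  simp only [map_add, Derivation.leibniz, Derivation.leibniz_pow, smul_eq_mul, nsmul_eq_mul,
    map_mul, map_pow, map_natCast, PowerSeries.derivative_X, map_one, hp, hX, Nat.add_sub_cancel]
  ring

/-- The Euler operator `θᵢ` as a derivation. -/
def eulerD (i : Fin 2) : Derivation ℂ Ser Ser := (X i : Ser) • pderiv ℂ i

theorem eulerD_apply (i : Fin 2) (F : Ser) : eulerD i F = euler i F := rfl

theorem euler_mul (i : Fin 2) (F G : Ser) : euler i (F * G) = euler i F * G + F * euler i G := by
  simp only [← eulerD_apply, Derivation.leibniz, smul_eq_mul]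
  ring

theorem euler_inv (i : Fin 2) (F : Ser) : euler i F⁻¹ = -F⁻¹ ^ 2 * euler i F := by
  change X i * pderiv ℂ i F⁻¹ = -F⁻¹ ^ 2 * (X i * pderiv ℂ i F)
  rw [pderiv_inv']
  ring

theorem euler_subst (i : Fin 2) {A : Ser} (hA : constantCoeff A = 0) (φ : ℂ⟦X⟧) :
    euler i (φ.subst A) = (PowerSeries.derivative ℂ φ).subst A * euler i A :=
  derivation_subst (eulerD i) hA φ

theorem col_euler_zero (m : ℕ) (F : Ser) : col m (euler 0 F) = qD (col m F) := by
  ext n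
  rw [coeff_col, coeff_euler, coeff_qD, coeff_col, ex_zero]

theorem col_euler_one (m : ℕ) (F : Ser) : col m (euler 1 F) = (m : ℂ) • col m F := by
  ext n
  rw [coeff_col, coeff_euler, ex_one, map_smul, coeff_col, smul_eq_mul]

end ChainRule

/-! ### Substitution of `q_E` -/

section Substitution

open MvPowerSeries

/-- The series `S / X₀`, for which `q_E = z₁ exp (S / X₀)`. -/
def logqE : Ser := S * X₀⁻¹

theorem euler_z₁ (i : Fin 2) : euler i z₁ = z₁ * if i = 0 then 1 else 0 := by
  change X i * pderiv ℂ i (X 0) = _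
  rw [pderiv_X]
  fin_cases i <;> simp [z₁]

theorem euler_qE (i : Fin 2) : euler i qE = (euler i logqE + if i = 0 then 1 else 0) * qE := by
  have hlog : constantCoeff logqE = 0 := by simp [logqE, S_constantCoeff]
  have hqE : qE = z₁ * PowerSeries.subst logqE (PowerSeries.exp ℂ) := rfl
  rw [hqE, euler_mul, euler_z₁, euler_subst i hlog, PowerSeries.derivative_exp]
  ring

/-- Substitution of `q_E` for `q`, as an algebra homomorphism. -/
def atEHom : ℂ⟦X⟧ →ₐ[ℂ] Ser := PowerSeries.substAlgHom hasSubst_qE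

theorem atEHom_apply (φ : ℂ⟦X⟧) : atEHom φ = atE φ := by
  rw [atEHom, PowerSeries.coe_substAlgHom]; rfl

theorem atEHom_X : atEHom PowerSeries.X = qE := by
  rw [atEHom_apply, atE, PowerSeries.subst_X hasSubst_qE]

theorem euler_atEHom (i : Fin 2) (φ : ℂ⟦X⟧) : euler i (atEHom φ) =
    (euler i logqE + if i = 0 then 1 else 0) * atEHom (qD φ) := by
  rw [qD_apply, map_mul, atEHom_X, atEHom_apply, atEHom_apply, atE,
    euler_subst i qE_constantCoeff, euler_qE, atE]
  ring

theorem constantCoeff_atEHom (φ : ℂ⟦X⟧) :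
    constantCoeff (atEHom φ) = PowerSeries.constantCoeff φ := by
  rw [atEHom_apply, atE, constantCoeff_subst_of_constantCoeff_eq_zero qE_constantCoeff]

end Substitution

/-! ### Polynomials with a degree bound and a parity -/

section Parity

open Polynomial

variable (R : Type*) [CommRing R]

/-- The polynomials of degree at most `d` all of whose exponents have the parity of `d`. -/
def parityDegreeLE (d : ℤ) : Submodule R R[X] :=
  Submodule.span R {p | ∃ i k : ℕ, (i : ℤ) + 2 * k = d ∧ p = X ^ i}

variable {R}

theorem X_pow_mem_parityDegreeLE {d : ℤ} (i k : ℕ) (h : (i : ℤ) + 2 * k = d) :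
    X ^ i ∈ parityDegreeLE R d := Submodule.subset_span ⟨i, k, h, rfl⟩

theorem parityDegreeLE_le_add_two (d : ℤ) : parityDegreeLE R d ≤ parityDegreeLE R (d + 2) := by
  refine Submodule.span_mono ?_
  rintro _ ⟨i, k, rfl, rfl⟩
  exact ⟨i, k + 1, by push_cast; ring, rfl⟩

instance : SetLike.GradedMonoid (parityDegreeLE R) where
  one_mem := by simpa using X_pow_mem_parityDegreeLE (R := R) (d := 0) 0 0 (by simp)
  mul_mem a b p q hp hq := by
    have h := Submodule.mul_mem_mul hp hq
    rw [parityDegreeLE, parityDegreeLE, Submodule.span_mul_span] at h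
    refine Submodule.span_mono ?_ h
    rintro _ ⟨_, ⟨i, k, rfl, rfl⟩, _, ⟨j, l, rfl, rfl⟩, rfl⟩
    exact ⟨i + j, k + l, by push_cast; ring, (pow_add _ _ _).symm⟩

theorem aeval_mem_of_mem_parityDegreeLE {A : Type*} [Semiring A] [Algebra R A]
    (V : ℤ → Submodule R A) [SetLike.GradedMonoid V] (hV : ∀ d, V d ≤ V (d + 2)) {x : A}
    (hx : x ∈ V 1) {d : ℤ} {p : R[X]} (hp : p ∈ parityDegreeLE R d) : aeval x p ∈ V d := by
  have hpow (i k : ℕ) : x ^ i ∈ V (i + 2 * k) := by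
    induction k with
    | zero => simpa using SetLike.pow_mem_graded i hx
    | succ k ih => simpa [mul_add, ← add_assoc] using hV _ ih
  suffices h : parityDegreeLE R d ≤ (V d).comap (aeval x).toLinearMap from h hp
  refine Submodule.span_le.2 ?_
  rintro _ ⟨i, k, rfl, rfl⟩
  simpa using hpow i k

theorem parityDegreeLE_eq_bot {d : ℤ} (hd : d < 0) : parityDegreeLE R d = ⊥ := by
  rw [parityDegreeLE, Submodule.span_eq_bot]
  rintro _ ⟨i, k, h, -⟩
  omega

theorem derivative_mem_parityDegreeLE {d : ℤ} {p : R[X]} (hp : p ∈ parityDegreeLE R d) :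
    derivative p ∈ parityDegreeLE R (d - 1) := by
  suffices h : parityDegreeLE R d ≤ (parityDegreeLE R (d - 1)).comap derivative from h hp
  refine Submodule.span_le.2 ?_
  rintro _ ⟨i, k, rfl, rfl⟩
  cases i with
  | zero => simp
  | succ i =>
    rw [SetLike.mem_coe, Submodule.mem_comap, derivative_X_pow, ← smul_eq_C_mul]
    exact Submodule.smul_mem _ _ (X_pow_mem_parityDegreeLE i k (by push_cast; ring))

theorem X_pow_sub_X_pow_mod_two_eq (i k : ℕ) :
    ∃ q ∈ parityDegreeLE R (i + 2 * k - 2), X ^ i - X ^ (i % 2) = (1 - X ^ 2) * q := by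
  induction i using Nat.strong_induction_on generalizing k with
  | _ i ih =>
    rcases lt_or_ge i 2 with hi | hi
    · exact ⟨0, zero_mem _, by rw [Nat.mod_eq_of_lt hi]; simp⟩
    · obtain ⟨j, rfl⟩ := Nat.exists_eq_add_of_le' hi
      obtain ⟨q, hq, hj⟩ := ih j (by omega) (k + 1)
      have hd : (j : ℤ) + 2 * (k + 1 : ℕ) - 2 = (j + 2 : ℕ) + 2 * k - 2 := by push_cast; ring
      rw [hd] at hq
      refine ⟨q - X ^ j, sub_mem hq (X_pow_mem_parityDegreeLE j k (by push_cast; ring)), ?_⟩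
      rw [Nat.add_mod_right]
      linear_combination hj

theorem exists_eq_one_sub_X_sq_mul_add {d : ℤ} {p : R[X]} (hp : p ∈ parityDegreeLE R d) :
    ∃ q ∈ parityDegreeLE R (d - 2),
      p = (1 - X ^ 2) * q + C (p.eval 1) * X ^ (d % 2).toNat := by
  induction hp using Submodule.span_induction with
  | mem p hp =>
    obtain ⟨i, k, rfl, rfl⟩ := hp
    obtain ⟨q, hq, h⟩ := X_pow_sub_X_pow_mod_two_eq (R := R) i k
    refine ⟨q, hq, ?_⟩
    rw [← h, show ((i + 2 * k : ℤ) % 2).toNat = i % 2 by omega]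
    simp
  | zero => exact ⟨0, zero_mem _, by simp⟩
  | add p p' _ _ hp hp' =>
    obtain ⟨q, hq, h⟩ := hp
    obtain ⟨q', hq', h'⟩ := hp'
    refine ⟨q + q', add_mem hq hq', ?_⟩
    rw [eval_add, C_add]
    linear_combination h + h'
  | smul a p _ hp =>
    obtain ⟨q, hq, h⟩ := hp
    refine ⟨a • q, Submodule.smul_mem _ _ hq, ?_⟩
    rw [eval_smul, smul_eq_mul, C_mul, smul_eq_C_mul, smul_eq_C_mul]
    linear_combination C a * h

end Parity

/-! ### Polynomials in `1 - 864 z₁` -/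

section SPolynomials

open PowerSeries (constantCoeff)

theorem ofNat_mul_mem_iff {K A : Type*} [Field K] [CharZero K] [Semiring A] [Algebra K A]
    {V : Submodule K A} {a : A} (n : ℕ) [n.AtLeastTwo] : OfNat.ofNat n * a ∈ V ↔ a ∈ V := by
  have h : (OfNat.ofNat n : A) * a = (n : K) • a := by
    rw [Algebra.smul_def, map_natCast]; rfl
  rw [h, V.smul_mem_iff (Nat.cast_ne_zero.2 (NeZero.ne n))]

/-- The series `1 - 864 z₁`, in the single variable `z₁`. -/
def s₈₆₄ : ℂ⟦X⟧ := 1 - 864 * PowerSeries.X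

/-- The series `1 - 432 z₁`, in the single variable `z₁`. -/
def r₄₃₂ : ℂ⟦X⟧ := 1 - 432 * PowerSeries.X

theorem constantCoeff_s₈₆₄ : constantCoeff s₈₆₄ = 1 := by simp [s₈₆₄]

theorem constantCoeff_r₄₃₂ : constantCoeff r₄₃₂ = 1 := by simp [r₄₃₂]

theorem r₄₃₂_pow_mul_inv_pow (n : ℕ) : r₄₃₂ ^ n * r₄₃₂⁻¹ ^ n = 1 := by
  rw [← mul_pow, PowerSeries.mul_inv_cancel _ (by simp [constantCoeff_r₄₃₂]), one_pow]

theorem qD_X : qD PowerSeries.X = PowerSeries.X := by simp [qD_apply]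

theorem qD_ofNat (n : ℕ) [n.AtLeastTwo] : qD (OfNat.ofNat n) = 0 := qD.map_natCast n

theorem qD_s₈₆₄ : qD s₈₆₄ = -864 * PowerSeries.X := by
  rw [s₈₆₄, map_sub, qD.map_one_eq_zero, qD.leibniz, qD_X, qD_ofNat, smul_zero, smul_eq_mul]
  ring

theorem qD_r₄₃₂ : qD r₄₃₂ = -432 * PowerSeries.X := by
  rw [r₄₃₂, map_sub, qD.map_one_eq_zero, qD.leibniz, qD_X, qD_ofNat, smul_zero, smul_eq_mul]
  ring

theorem X_mul_r₄₃₂ : 1728 * (PowerSeries.X * r₄₃₂) = 1 - s₈₆₄ ^ 2 := by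
  rw [r₄₃₂, s₈₆₄]; ring

/-- The polynomials in `s = 1 - 864 z₁` of degree at most `d` and of the parity of `d`. -/
def sPoly (d : ℤ) : Submodule ℂ ℂ⟦X⟧ :=
  (parityDegreeLE ℂ d).map (Polynomial.aeval s₈₆₄).toLinearMap

theorem mem_sPoly {d : ℤ} {φ : ℂ⟦X⟧} :
    φ ∈ sPoly d ↔ ∃ p ∈ parityDegreeLE ℂ d, Polynomial.aeval s₈₆₄ p = φ := Submodule.mem_map

instance : SetLike.GradedMonoid sPoly where
  one_mem := mem_sPoly.2 ⟨1, SetLike.one_mem_graded _, map_one _⟩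
  mul_mem a b φ ψ hφ hψ := by
    obtain ⟨p, hp, rfl⟩ := mem_sPoly.1 hφ
    obtain ⟨q, hq, rfl⟩ := mem_sPoly.1 hψ
    exact mem_sPoly.2 ⟨p * q, SetLike.mul_mem_graded hp hq, map_mul _ _ _⟩

theorem sPoly_le_add_two (d : ℤ) : sPoly d ≤ sPoly (d + 2) :=
  Submodule.map_mono (parityDegreeLE_le_add_two d)

theorem s₈₆₄_mem_sPoly : s₈₆₄ ∈ sPoly 1 :=
  mem_sPoly.2 ⟨Polynomial.X, by simpa using X_pow_mem_parityDegreeLE 1 0 rfl, Polynomial.aeval_X _⟩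

theorem eq_zero_of_mem_sPoly {d : ℤ} (hd : d < 0) {φ : ℂ⟦X⟧} (h : φ ∈ sPoly d) : φ = 0 := by
  rwa [sPoly, parityDegreeLE_eq_bot hd, Submodule.map_bot, Submodule.mem_bot] at h

theorem one_mem_sPoly_two : (1 : ℂ⟦X⟧) ∈ sPoly 2 :=
  sPoly_le_add_two 0 (SetLike.one_mem_graded sPoly)

theorem X_mul_r₄₃₂_mem_sPoly : PowerSeries.X * r₄₃₂ ∈ sPoly 2 := by
  refine (ofNat_mul_mem_iff 1728).1 ?_
  rw [X_mul_r₄₃₂]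
  exact sub_mem one_mem_sPoly_two (SetLike.pow_mem_graded 2 s₈₆₄_mem_sPoly)

theorem constantCoeff_aeval_s₈₆₄ (p : Polynomial ℂ) :
    constantCoeff (Polynomial.aeval s₈₆₄ p) = p.eval 1 := by
  have h : (constantCoeff (R := ℂ)).comp (algebraMap ℂ ℂ⟦X⟧) = RingHom.id ℂ := by ext; simp
  rw [Polynomial.aeval_def, Polynomial.hom_eval₂, constantCoeff_s₈₆₄, h, Polynomial.eval]

theorem exists_eq_one_sub_s₈₆₄_sq_mul {d : ℤ} {φ : ℂ⟦X⟧} (h : φ ∈ sPoly d)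
    (hφ : constantCoeff φ = 0) : ∃ ψ ∈ sPoly (d - 2), φ = (1 - s₈₆₄ ^ 2) * ψ := by
  obtain ⟨p, hp, rfl⟩ := mem_sPoly.1 h
  obtain ⟨q, hq, hpq⟩ := exists_eq_one_sub_X_sq_mul_add hp
  rw [← constantCoeff_aeval_s₈₆₄, hφ] at hpq
  exact ⟨_, mem_sPoly.2 ⟨q, hq, rfl⟩, by rw [hpq]; simp⟩

theorem r₄₃₂_mul_qD_mem_sPoly {d : ℤ} {φ : ℂ⟦X⟧} (h : φ ∈ sPoly d) :
    r₄₃₂ * qD φ ∈ sPoly (d + 1) := by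
  obtain ⟨p, hp, rfl⟩ := mem_sPoly.1 h
  have hD : r₄₃₂ * qD (Polynomial.aeval s₈₆₄ p) =
      -(864 * (Polynomial.aeval s₈₆₄ p.derivative * (PowerSeries.X * r₄₃₂))) := by
    rw [Derivation.comp_aeval_eq, smul_eq_mul, qD_s₈₆₄]; ring
  rw [hD]
  refine neg_mem ((ofNat_mul_mem_iff 864).2 ?_)
  have := SetLike.mul_mem_graded (mem_sPoly.2 ⟨_, derivative_mem_parityDegreeLE hp, rfl⟩)
    X_mul_r₄₃₂_mem_sPoly
  rwa [show d - 1 + 2 = d + 1 by ring] at this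

end SPolynomials

/-! ### The filtration -/

section Filtration

open MvPowerSeries

/-- The condition that `fil j` imposes on the coefficient of `z₂ ^ m`. -/
def filCol (j : ℤ) (m : ℕ) : Submodule ℂ Ser :=
  (sPoly (3 * m + j)).comap (LinearMap.mulLeft ℂ (r₄₃₂ ^ (3 * m)) ∘ₗ col m)

/-- The series `∑ pₘ(s) yᵐ`, where `s = 1 - 864 z₁` and `y = z₂ / (1 - 432 z₁) ^ 3`, with `pₘ` a
polynomial of degree at most `3 m + j` and of the parity of `3 m + j`. -/
def fil (j : ℤ) : Submodule ℂ Ser := ⨅ m, filCol j m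

theorem mem_filCol {j : ℤ} {m : ℕ} {F : Ser} :
    F ∈ filCol j m ↔ r₄₃₂ ^ (3 * m) * col m F ∈ sPoly (3 * m + j) := Iff.rfl

theorem mem_fil {j : ℤ} {F : Ser} : F ∈ fil j ↔ ∀ m, F ∈ filCol j m := Submodule.mem_iInf _

theorem filCol_le_add_two (j : ℤ) (m : ℕ) : filCol j m ≤ filCol (j + 2) m := fun F hF => by
  rw [mem_filCol, ← add_assoc]
  exact sPoly_le_add_two _ hF

theorem fil_le_add_two (j : ℤ) : fil j ≤ fil (j + 2) :=
  iInf_mono fun m => filCol_le_add_two j m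

theorem mul_mem_filCol {i j : ℤ} {m : ℕ} {F G : Ser}
    (h : ∀ p ∈ Finset.HasAntidiagonal.antidiagonal m,
      col p.1 F = 0 ∨ F ∈ filCol i p.1 ∧ G ∈ filCol j p.2) :
    F * G ∈ filCol (i + j) m := by
  rw [mem_filCol, col_mul, Finset.mul_sum]
  refine sum_mem fun p hp => ?_
  obtain rfl := Finset.HasAntidiagonal.mem_antidiagonal.1 hp
  rcases h p hp with hF | ⟨hF, hG⟩
  · simp [hF]
  · convert SetLike.mul_mem_graded (mem_filCol.1 hF) (mem_filCol.1 hG) using 1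
    · congr 1; push_cast; ring
    · ring

theorem mul_mem_filCol_of_lt {i j : ℤ} {m : ℕ} {F G : Ser} (hF : F ∈ fil i) (hF₀ : col 0 F = 0)
    (hG : ∀ n < m, G ∈ filCol j n) : F * G ∈ filCol (i + j) m := by
  refine mul_mem_filCol fun p hp => ?_
  have hm := Finset.HasAntidiagonal.mem_antidiagonal.1 hp
  rcases Nat.eq_zero_or_pos p.1 with h | h
  · exact Or.inl (by rw [h, hF₀])
  · exact Or.inr ⟨mem_fil.1 hF _, hG _ (by omega)⟩

theorem inc_mem_fil {j : ℤ} {φ : ℂ⟦X⟧} (h : φ ∈ sPoly j) : inc φ ∈ fil j :=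
  mem_fil.2 fun m => by
    rw [mem_filCol, col_inc]
    rcases eq_or_ne m 0 with rfl | hm
    · simpa using h
    · simp [hm]

instance : SetLike.GradedMonoid fil where
  one_mem := by simpa using inc_mem_fil (SetLike.one_mem_graded sPoly)
  mul_mem _ _ _ _ hF hG :=
    mem_fil.2 fun _ => mul_mem_filCol fun _ _ => Or.inr ⟨mem_fil.1 hF _, mem_fil.1 hG _⟩

theorem euler_one_mem_fil {j : ℤ} {F : Ser} (h : F ∈ fil j) : euler 1 F ∈ fil j :=
  mem_fil.2 fun m => by
    rw [mem_filCol, col_euler_one, mul_smul_comm]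
    exact Submodule.smul_mem _ _ (mem_fil.1 h m)

theorem subst_mem_fil {A : Ser} (hA : A ∈ fil 0) (hA₀ : col 0 A = 0) (φ : ℂ⟦X⟧) :
    φ.subst A ∈ fil 0 := by
  refine mem_fil.2 fun m => ?_
  have hs := PowerSeries.HasSubst.of_constantCoeff_zero (a := A)
    (by rw [← constantCoeff_col_zero, hA₀, map_zero])
  set p := φ.trunc (m + 1)
  have hp : Polynomial.aeval A p ∈ fil 0 := by
    rw [show A = (⟨A, hA⟩ : SetLike.GradeZero.subalgebra fil) from rfl, Subalgebra.aeval_coe]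
    exact SetLike.coe_mem _
  have hdvd : z₂ ^ (m + 1) ∣ φ.subst A - Polynomial.aeval A p := by
    rw [PowerSeries.eq_X_pow_mul_shift_add_trunc (m + 1) φ, PowerSeries.subst_add hs,
      PowerSeries.subst_mul hs, PowerSeries.subst_pow hs, PowerSeries.subst_X hs,
      PowerSeries.subst_coe hs, add_sub_cancel_right]
    have : z₂ ∣ A := by simpa [hA₀] using z₂_pow_dvd_iff 1 A
    exact (pow_dvd_pow_of_dvd this _).mul_right _
  have hcol := (z₂_pow_dvd_iff _ _).1 hdvd m (Nat.lt_succ_self m)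
  rw [map_sub, sub_eq_zero] at hcol
  rw [mem_filCol, hcol]
  exact mem_fil.1 hp m

end Filtration

/-! ### Rational powers -/

section RatPow

open MvPowerSeries

theorem mul_inv_cancel_of_constantCoeff_eq_one {σ K : Type*} [Field K] {F : MvPowerSeries σ K}
    (h : constantCoeff F = 1) : F * F⁻¹ = 1 :=
  MvPowerSeries.mul_inv_cancel F (by rw [h]; exact one_ne_zero)

theorem hasSubst_sub_one {F : Ser} (h : constantCoeff F = 1) : PowerSeries.HasSubst (F - 1) :=
  PowerSeries.HasSubst.of_constantCoeff_zero (by rw [map_sub, h, map_one, sub_self])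

theorem ratPow_zero {F : Ser} (h : constantCoeff F = 1) : ratPow F 0 = 1 := by
  rw [ratPow, PowerSeries.binomialSeries_zero, ← PowerSeries.coe_substAlgHom (hasSubst_sub_one h),
    map_one]

theorem ratPow_mul_ratPow_neg {F : Ser} (h : constantCoeff F = 1) (r : ℚ) :
    ratPow F r * ratPow F (-r) = 1 := by
  rw [← ratPow_add F (hasSubst_sub_one h), add_neg_cancel, ratPow_zero h]

theorem ratPow_pow {F : Ser} (h : constantCoeff F = 1) (r : ℚ) (n : ℕ) :
    ratPow F r ^ n = ratPow F (n * r) := by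
  induction n with
  | zero => rw [Nat.cast_zero, zero_mul, ratPow_zero h, pow_zero]
  | succ n ih =>
    rw [Nat.cast_succ, add_mul, ratPow_add F (hasSubst_sub_one h), ← ih, one_mul, pow_succ]

theorem ratPow_natCast {F : Ser} (h : constantCoeff F = 1) (n : ℕ) : ratPow F n = F ^ n := by
  rw [← mul_one (n : ℚ), ← ratPow_pow h, ratPow_one F (hasSubst_sub_one h)]

theorem constantCoeff_ratPow {F : Ser} (h : constantCoeff F = 1) (r : ℚ) :
    constantCoeff (ratPow F r) = 1 := by
  rw [ratPow, constantCoeff_subst_of_constantCoeff_eq_zero (by rw [map_sub, h, map_one, sub_self]),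
    PowerSeries.binomialSeries_constantCoeff]

theorem eq_of_pow_eq_pow {σ R : Type*} [CommRing R] [IsDomain R] [CharZero R]
    {F G : MvPowerSeries σ R} (hF : constantCoeff F = 1) (hG : constantCoeff G = 1) {n : ℕ}
    (hn : n ≠ 0) (h : F ^ n = G ^ n) : F = G := by
  have hmul := geom_sum₂_mul F G n
  rw [h, sub_self, mul_eq_zero, sub_eq_zero] at hmul
  refine hmul.resolve_left fun hsum => hn ?_
  have hcoeff := congrArg constantCoeff hsum
  simpa [hF, hG] using hcoeff

theorem ratPow_neg {F : Ser} (h : constantCoeff F = 1) (r : ℚ) :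
    ratPow F (-r) = (ratPow F r)⁻¹ := by
  rw [MvPowerSeries.eq_inv_iff_mul_eq_one (by rw [constantCoeff_ratPow h]; exact one_ne_zero),
    mul_comm, ratPow_mul_ratPow_neg h]

theorem mul_ratPow {F G : Ser} (hF : constantCoeff F = 1) (hG : constantCoeff G = 1) (r : ℚ) :
    ratPow (F * G) r = ratPow F r * ratPow G r := by
  have hFG : constantCoeff (F * G) = 1 := by rw [map_mul, hF, hG, one_mul]
  have hdiv (n b : ℕ) (hb : b ≠ 0) :
      ratPow (F * G) (n / b) = ratPow F (n / b) * ratPow G (n / b) := by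
    have hr : (b : ℚ) * (n / b) = n := mul_div_cancel₀ _ (Nat.cast_ne_zero.2 hb)
    refine eq_of_pow_eq_pow (constantCoeff_ratPow hFG _) ?_ hb ?_
    · rw [map_mul, constantCoeff_ratPow hF, constantCoeff_ratPow hG, one_mul]
    · rw [mul_pow, ratPow_pow hFG, ratPow_pow hF, ratPow_pow hG, hr, ratPow_natCast hFG,
        ratPow_natCast hF, ratPow_natCast hG, mul_pow]
  have hr := r.num_div_den
  rcases r.num.eq_nat_or_neg with ⟨n, hn | hn⟩ <;> rw [hn] at hr <;> push_cast at hr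
  · rw [← hr, hdiv n r.den r.den_ne_zero]
  · rw [← hr, neg_div, ratPow_neg hFG, ratPow_neg hF, ratPow_neg hG, hdiv n r.den r.den_ne_zero,
      MvPowerSeries.mul_inv_rev, mul_comm]

theorem one_ratPow (r : ℚ) : ratPow 1 r = 1 := by
  have h₁ : constantCoeff (1 : Ser) = 1 := map_one _
  have hsq := mul_ratPow h₁ h₁ r
  rw [mul_one] at hsq
  refine (mul_eq_left₀ fun h => ?_).1 hsq.symm
  simpa [h] using constantCoeff_ratPow h₁ r

theorem pow_ratPow {F : Ser} (h : constantCoeff F = 1) (n : ℕ) (r : ℚ) :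
    ratPow (F ^ n) r = ratPow F r ^ n := by
  induction n with
  | zero => rw [pow_zero, pow_zero, one_ratPow]
  | succ n ih => rw [pow_succ, mul_ratPow (by rw [map_pow, h, one_pow]) h, ih, pow_succ]

theorem pow_mul_ratPow_mul_pow_neg {F G : Ser} (hF : constantCoeff F = 1)
    (hG : constantCoeff G = 1) {n k : ℕ} {r : ℚ} (h : n * r = k) :
    G ^ k * ratPow (F * G ^ n) (-r) = ratPow F (-r) := by
  have hGn : constantCoeff (G ^ n) = 1 := by rw [map_pow, hG, one_pow]
  rw [← ratPow_natCast hG, ← h, ← ratPow_pow hG, ← pow_ratPow hG, mul_ratPow hF hGn, mul_left_comm,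
    ratPow_mul_ratPow_neg hGn, mul_one]

theorem constantCoeff_eq_one_of_col_zero {F : Ser} (h : col 0 F = 1) : constantCoeff F = 1 := by
  rw [← constantCoeff_col_zero, h, map_one]

theorem ratPow_mem_fil {F : Ser} (hF : F ∈ fil 0) (h : col 0 F = 1) (r : ℚ) :
    ratPow F r ∈ fil 0 :=
  subst_mem_fil (sub_mem hF (SetLike.one_mem_graded fil)) (by simp [h, col_one]) _

theorem inv_mem_fil {F : Ser} (hF : F ∈ fil 0) (h : col 0 F = 1) : F⁻¹ ∈ fil 0 := by
  have hc := constantCoeff_eq_one_of_col_zero h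
  have hinv : F⁻¹ = ratPow F (-1) := by
    rw [MvPowerSeries.inv_eq_iff_mul_eq_one (by rw [hc]; exact one_ne_zero), mul_comm]
    simpa only [ratPow_one F (hasSubst_sub_one hc)] using ratPow_mul_ratPow_neg hc 1
  rw [hinv]
  exact ratPow_mem_fil hF h _

end RatPow

/-! ### The periods column by column -/

section Periods

open PowerSeries (constantCoeff)

/-- The operator `z d/dz` on pairs `(φ, ψ)`, which stand for `φ log z + ψ`. -/
def qDLog : Module.End ℂ (ℂ⟦X⟧ × ℂ⟦X⟧) where
  toFun w := (qD w.1, qD w.2 + w.1)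
  map_add' v w := by ext1 <;> simp [add_add_add_comm]
  map_smul' c w := by ext1 <;> simp

theorem qDLog_apply (w : ℂ⟦X⟧ × ℂ⟦X⟧) : qDLog w = (qD w.1, qD w.2 + w.1) := rfl

theorem qDLog_smul (φ : ℂ⟦X⟧) (w : ℂ⟦X⟧ × ℂ⟦X⟧) :
    qDLog (φ • w) = qD φ • w + φ • qDLog w := by
  ext1 <;> simp only [qDLog_apply, Prod.smul_fst, Prod.smul_snd, Prod.fst_add, Prod.snd_add,
    smul_eq_mul, qD.leibniz] <;> ring

/-- The coefficient of `z₂ ^ m` in `F log z₁ + G`. -/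
def colLog (m : ℕ) : LogSer →ₗ[ℂ] ℂ⟦X⟧ × ℂ⟦X⟧ := (col m).prodMap (col m)

theorem colLog_apply (m : ℕ) (w : LogSer) : colLog m w = (col m w.1, col m w.2) := rfl

theorem coeff_natCast_mul (k n : ℕ) (φ : ℂ⟦X⟧) :
    PowerSeries.coeff n ((k : ℂ⟦X⟧) * φ) = k * PowerSeries.coeff n φ := by
  rw [← nsmul_eq_mul, map_nsmul, nsmul_eq_mul]

theorem coeff_ofNat_mul (k : ℕ) [k.AtLeastTwo] (n : ℕ) (φ : ℂ⟦X⟧) :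
    PowerSeries.coeff n (ofNat(k) * φ) = ofNat(k) * PowerSeries.coeff n φ :=
  coeff_natCast_mul k n φ

theorem coeff_r₄₃₂_mul_succ (n : ℕ) (φ : ℂ⟦X⟧) : PowerSeries.coeff (n + 1) (r₄₃₂ * φ) =
    PowerSeries.coeff (n + 1) φ - 432 * PowerSeries.coeff n φ := by
  rw [r₄₃₂, sub_mul, one_mul, mul_assoc, map_sub, coeff_ofNat_mul, PowerSeries.coeff_succ_X_mul]

theorem qDLog_smul_qDLog_of_L₁ {w : LogSer} (h : L₁ w = 0) :
    qDLog (r₄₃₂ • qDLog (colLog 0 w)) = (60 * PowerSeries.X : ℂ⟦X⟧) • colLog 0 w := by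
  simp only [qDLog_apply, colLog_apply, Prod.smul_mk, smul_eq_mul, Prod.mk.injEq, mul_assoc]
  constructor <;> ext n <;> rcases n with _ | n
  · simp [-Derivation.leibniz, constantCoeff_qD]
  · have hn := coeff_L₁_fst_succ w n 0
    simp only [h, Prod.fst_zero, map_zero, Nat.cast_zero] at hn
    simp only [coeff_ofNat_mul, PowerSeries.coeff_succ_X_mul, coeff_qD,
      coeff_r₄₃₂_mul_succ, coeff_col]
    push_cast
    linear_combination -hn
  · simp [-Derivation.leibniz, constantCoeff_qD]
  · have hn := coeff_L₁_snd_succ w n 0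
    simp only [h, Prod.snd_zero, map_zero, Nat.cast_zero] at hn
    simp only [coeff_ofNat_mul, PowerSeries.coeff_succ_X_mul, map_add, coeff_qD,
      coeff_r₄₃₂_mul_succ, coeff_col]
    push_cast
    linear_combination -hn

/-- The operator `z ^ k (d/dz) ^ k` on pairs `(φ, ψ)`, which stand for `φ log z + ψ`. -/
def fallingLog (k : ℕ) : Module.End ℂ (ℂ⟦X⟧ × ℂ⟦X⟧) :=
  Polynomial.aeval qDLog (descPochhammer ℂ k)

theorem fallingLog_zero : fallingLog 0 = 1 := by simp [fallingLog]

theorem fallingLog_succ (k : ℕ) (w : ℂ⟦X⟧ × ℂ⟦X⟧) :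
    fallingLog (k + 1) w = qDLog (fallingLog k w) - (k : ℂ⟦X⟧) • fallingLog k w := by
  rw [fallingLog, descPochhammer_succ_right, mul_comm]
  simp [fallingLog, Nat.cast_smul_eq_nsmul]

theorem colLog_succ_of_L₂ {w : LogSer} (h : L₂ w = 0) {m : ℕ} {v : ℂ⟦X⟧ × ℂ⟦X⟧}
    (hm : colLog m w = fallingLog (3 * m) v) :
    ((m + 1) ^ 3 : ℂ) • colLog (m + 1) w = fallingLog (3 * (m + 1)) v := by
  rw [show 3 * (m + 1) = 3 * m + 1 + 1 + 1 by ring, fallingLog_succ, fallingLog_succ,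
    fallingLog_succ, ← hm]
  simp only [qDLog_apply, colLog_apply, Prod.smul_mk, Prod.mk_sub_mk, Prod.mk.injEq]
  constructor <;> ext n
  · have hn := coeff_L₂_fst_succ w n m
    simp only [h, Prod.fst_zero, map_zero] at hn
    simp only [smul_eq_mul, map_smul, map_sub, coeff_qD, coeff_natCast_mul, coeff_col]
    push_cast
    linear_combination -hn
  · have hn := coeff_L₂_snd_succ w n m
    simp only [h, Prod.snd_zero, map_zero] at hn
    simp only [smul_eq_mul, map_smul, map_add, map_sub, coeff_qD, coeff_natCast_mul, coeff_col]
    push_cast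
    linear_combination -hn

theorem colLog_of_L₂ {w : LogSer} (h : L₂ w = 0) (m : ℕ) :
    colLog m w = fallingLog (3 * m) (((m.factorial : ℂ) ^ 3)⁻¹ • colLog 0 w) := by
  induction m with
  | zero => simp [fallingLog_zero]
  | succ m ih =>
    have hm : ((m : ℂ) + 1) ^ 3 ≠ 0 := pow_ne_zero 3 (by exact_mod_cast m.succ_ne_zero)
    rw [← inv_smul_smul₀ hm (colLog (m + 1) w), colLog_succ_of_L₂ h ih, ← map_smul, smul_smul,
      ← mul_inv, ← mul_pow, Nat.factorial_succ, Nat.cast_mul, Nat.cast_succ]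

/-- The coefficients `(a, b)` in `(1 - 432 z) ^ k z ^ k (d/dz) ^ k w = a w + b (1 - 432 z) z dw/dz`
for solutions `w` of the hypergeometric equation at `z₂ = 0`. -/
def fallingCoeff : ℕ → ℂ⟦X⟧ × ℂ⟦X⟧
  | 0 => (1, 0)
  | k + 1 =>
    (r₄₃₂ * qD (fallingCoeff k).1 + 60 * (PowerSeries.X * r₄₃₂ * (fallingCoeff k).2) -
        (k : ℂ⟦X⟧) * (s₈₆₄ * (fallingCoeff k).1),
      (fallingCoeff k).1 + r₄₃₂ * qD (fallingCoeff k).2 -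
        (k : ℂ⟦X⟧) * (s₈₆₄ * (fallingCoeff k).2))

theorem fallingCoeff_mem_sPoly (k : ℕ) :
    (fallingCoeff k).1 ∈ sPoly k ∧ (fallingCoeff k).2 ∈ sPoly (k - 1) := by
  induction k with
  | zero => exact ⟨SetLike.one_mem_graded sPoly, zero_mem _⟩
  | succ k ih =>
    obtain ⟨ha, hb⟩ := ih
    have hDa := r₄₃₂_mul_qD_mem_sPoly ha
    have hDb := r₄₃₂_mul_qD_mem_sPoly hb
    have hsa := SetLike.mul_mem_graded s₈₆₄_mem_sPoly ha
    have hsb := SetLike.mul_mem_graded s₈₆₄_mem_sPoly hb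
    have hXb := SetLike.mul_mem_graded X_mul_r₄₃₂_mem_sPoly hb
    rw [sub_add_cancel] at hDb
    rw [add_comm] at hsa
    rw [add_sub_cancel] at hsb
    rw [show 2 + ((k : ℤ) - 1) = k + 1 by ring] at hXb
    rw [Nat.cast_succ, add_sub_cancel_right]
    simp only [fallingCoeff, ← nsmul_eq_mul (_ : ℕ) (_ : ℂ⟦X⟧)]
    exact ⟨sub_mem (add_mem hDa ((ofNat_mul_mem_iff 60).2 hXb)) (nsmul_mem hsa k),
      sub_mem (add_mem ha hDb) (nsmul_mem hsb k)⟩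

theorem r₄₃₂_mul_qD_r₄₃₂_pow (k : ℕ) :
    r₄₃₂ * qD (r₄₃₂ ^ k) = -432 * (k : ℂ⟦X⟧) * PowerSeries.X * r₄₃₂ ^ k := by
  cases k with
  | zero => simp
  | succ k =>
    rw [qD.leibniz_pow, qD_r₄₃₂, nsmul_eq_mul, smul_eq_mul, Nat.add_sub_cancel]
    ring

theorem r₄₃₂_pow_smul_fallingLog {w : ℂ⟦X⟧ × ℂ⟦X⟧}
    (h : qDLog (r₄₃₂ • qDLog w) = (60 * PowerSeries.X : ℂ⟦X⟧) • w) (k : ℕ) :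
    r₄₃₂ ^ k • fallingLog k w =
      (fallingCoeff k).1 • w + (fallingCoeff k).2 • r₄₃₂ • qDLog w := by
  induction k with
  | zero => simp [fallingLog_zero, fallingCoeff]
  | succ k ih =>
    have hD := congrArg (fun v => r₄₃₂ • qDLog v) ih
    simp only [map_add, qDLog_smul _ (fallingLog k w), qDLog_smul (fallingCoeff k).1,
      qDLog_smul (fallingCoeff k).2, h] at hD
    have hr := r₄₃₂_mul_qD_r₄₃₂_pow k
    have hs : s₈₆₄ = r₄₃₂ - 432 * PowerSeries.X := by rw [s₈₆₄, r₄₃₂]; ring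
    simp only [Prod.ext_iff, Prod.fst_add, Prod.snd_add, Prod.smul_fst, Prod.smul_snd,
      smul_eq_mul] at hD ih
    simp only [fallingLog_succ, fallingCoeff, hs, Prod.ext_iff, Prod.fst_add, Prod.snd_add,
      Prod.fst_sub, Prod.snd_sub, Prod.smul_fst, Prod.smul_snd, smul_eq_mul]
    constructor
    · linear_combination hD.1 - k * (r₄₃₂ - 432 * PowerSeries.X) * ih.1 - (fallingLog k w).1 * hr
    · linear_combination hD.2 - k * (r₄₃₂ - 432 * PowerSeries.X) * ih.2 - (fallingLog k w).2 * hr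

theorem exists_eq_smul_add_smul_of_L₁_L₂ : ∃ P ∈ fil 0, ∃ Q ∈ fil (-1), col 0 P = 1 ∧
    ∀ w : LogSer, L₁ w = 0 → L₂ w = 0 → ∀ m, colLog m w =
      col m P • colLog 0 w + col m Q • r₄₃₂ • qDLog (colLog 0 w) := by
  let u (m : ℕ) : ℂ⟦X⟧ := ((m.factorial : ℂ) ^ 3)⁻¹ • r₄₃₂⁻¹ ^ (3 * m)
  have hu (m : ℕ) (φ : ℂ⟦X⟧) :
      r₄₃₂ ^ (3 * m) * (u m * φ) = ((m.factorial : ℂ) ^ 3)⁻¹ • φ := by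
    rw [← mul_assoc, mul_smul_comm, r₄₃₂_pow_mul_inv_pow, smul_one_mul]
  refine ⟨ofCol fun m => u m * (fallingCoeff (3 * m)).1, mem_fil.2 fun m => ?_,
    ofCol fun m => u m * (fallingCoeff (3 * m)).2, mem_fil.2 fun m => ?_, ?_,
    fun w h₁ h₂ m => ?_⟩
  · rw [mem_filCol, col_ofCol, hu]
    refine Submodule.smul_mem _ _ ?_
    simpa using (fallingCoeff_mem_sPoly (3 * m)).1
  · rw [mem_filCol, col_ofCol, hu]
    refine Submodule.smul_mem _ _ ?_
    simpa [← sub_eq_add_neg] using (fallingCoeff_mem_sPoly (3 * m)).2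
  · simp [u, fallingCoeff]
  · rw [col_ofCol, col_ofCol, mul_smul, mul_smul, ← smul_add,
      ← r₄₃₂_pow_smul_fallingLog (qDLog_smul_qDLog_of_L₁ h₁), colLog_of_L₂ h₂, map_smul,
      smul_smul, mul_comm (u m), mul_smul_comm, r₄₃₂_pow_mul_inv_pow, smul_one_smul]

/-- The period `X₀` at `z₂ = 0`. -/
def f₀ : ℂ⟦X⟧ := col 0 X₀

/-- The series part of the period `f₀ log z + g₀`, which is `X₁` at `z₂ = 0`. -/
def g₀ : ℂ⟦X⟧ := col 0 S

/-- The derivative `(1 - 432 z) z d/dz` of `f₀`. -/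
def v₀ : ℂ⟦X⟧ := r₄₃₂ * qD f₀

/-- The series part of the derivative `(1 - 432 z) z d/dz` of `f₀ log z + g₀`. -/
def u₀ : ℂ⟦X⟧ := r₄₃₂ * (qD g₀ + f₀)

theorem qD_v₀_and_qD_u₀ :
    qD v₀ = 60 * (PowerSeries.X * f₀) ∧ qD u₀ + v₀ = 60 * (PowerSeries.X * g₀) := by
  have h := Prod.ext_iff.1 (qDLog_smul_qDLog_of_L₁ L₁_X₁)
  simp only [← mul_assoc]
  exact h

theorem constantCoeff_f₀ : constantCoeff f₀ = 1 := by
  rw [f₀, constantCoeff_col_zero, X₀_constantCoeff]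

theorem constantCoeff_g₀ : constantCoeff g₀ = 0 := by
  rw [g₀, constantCoeff_col_zero, S_constantCoeff]

theorem coeff_one_f₀ : PowerSeries.coeff 1 f₀ = 60 := by
  have h := coeff_L₁_fst_succ (X₀, S) 0 0
  rw [L₁_X₁, ← coeff_col, ← coeff_col (F := X₀), ← coeff_col, ← f₀,
    PowerSeries.coeff_zero_eq_constantCoeff_apply, constantCoeff_f₀] at h
  norm_num at h
  linear_combination -h

theorem eq_of_qD_eq_zero {φ : ℂ⟦X⟧} (h : qD φ = 0) : φ = PowerSeries.C (constantCoeff φ) := by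
  ext n
  rcases n with _ | n
  · simp
  · have hn := congrArg (PowerSeries.coeff (n + 1)) h
    rw [coeff_qD, map_zero, mul_eq_zero, Nat.cast_eq_zero] at hn
    rw [hn.resolve_left n.succ_ne_zero, PowerSeries.coeff_C, if_neg n.succ_ne_zero]

theorem wronskian : u₀ * f₀ - v₀ * g₀ = 1 := by
  obtain ⟨hv, hu⟩ := qD_v₀_and_qD_u₀
  have hD : qD (u₀ * f₀ - v₀ * g₀) = 0 := by
    simp only [map_sub, qD.leibniz, smul_eq_mul, hv, eq_sub_of_add_eq hu]
    rw [u₀, v₀]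
    ring
  rw [eq_of_qD_eq_zero hD]
  simp [u₀, v₀, constantCoeff_qD, constantCoeff_r₄₃₂, constantCoeff_f₀, constantCoeff_g₀]

theorem exists_periods_eq : ∃ P ∈ fil 0, ∃ Q ∈ fil (-1), col 0 P = 1 ∧
    X₀ = P * inc f₀ + Q * inc v₀ ∧ S = P * inc g₀ + Q * inc u₀ := by
  obtain ⟨P, hP, Q, hQ, hP₀, h⟩ := exists_eq_smul_add_smul_of_L₁_L₂
  have hcol (m : ℕ) := Prod.ext_iff.1 (h (X₀, S) L₁_X₁ L₂_X₁ m)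
  refine ⟨P, hP, Q, hQ, hP₀, col_ext fun m => ?_, col_ext fun m => ?_⟩
  all_goals
    rw [mul_comm P, mul_comm Q, map_add, col_inc_mul, col_inc_mul, mul_comm,
      mul_comm _ (col m Q)]
  · exact (hcol m).1
  · exact (hcol m).2

end Periods

/-! ### Rescaling and uniqueness for the Ramanujan equations -/

section Ramanujan

open PowerSeries (constantCoeff)

/-- Ramanujan's differential equations for a derivation `δ`, with the time change `L` and with the
source term `E` in the quasimodular equation. -/
structure RamanujanSystem {A : Type*} [CommRing A] [Algebra ℂ A] (δ : Derivation ℂ A A)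
    (L E a₂ a₄ a₆ : A) : Prop where
  two : 12 * δ a₂ = L * (a₂ ^ 2 - a₄) - E
  four : 3 * δ a₄ = L * (a₂ * a₄ - a₆)
  six : 2 * δ a₆ = L * (a₂ * a₆ - a₄ ^ 2)

theorem ramanujanSystem_qD : RamanujanSystem qD 1 0 e2 e4 e6 := by
  have h (n : ℕ) [n.AtLeastTwo] (φ : ℂ⟦X⟧) :
      OfNat.ofNat n * (((OfNat.ofNat n : ℂ)⁻¹) • φ) = φ := by
    rw [← map_ofNat (algebraMap ℂ ℂ⟦X⟧) n, ← Algebra.smul_def,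
      smul_inv_smul₀ (Nat.cast_ne_zero.2 (NeZero.ne n))]
  exact ⟨by rw [qD_e2, h, one_mul, sub_zero], by rw [qD_e4, h, one_mul],
    by rw [qD_e6, h, one_mul]⟩

namespace RamanujanSystem

variable {A B : Type*} [CommRing A] [Algebra ℂ A] [CommRing B] [Algebra ℂ B]
  {δ : Derivation ℂ A A}

theorem map {L E a₂ a₄ a₆ : A} (h : RamanujanSystem δ L E a₂ a₄ a₆) (f : A →ₐ[ℂ] B)
    {δ' : Derivation ℂ B B} (c : B) (hf : ∀ a, δ' (f a) = c * f (δ a)) :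
    RamanujanSystem δ' (c * f L) (c * f E) (f a₂) (f a₄) (f a₆) := by
  have h₂ := congrArg f h.two
  have h₄ := congrArg f h.four
  have h₆ := congrArg f h.six
  simp only [map_mul, map_sub, map_pow, map_ofNat] at h₂ h₄ h₆
  constructor <;> rw [hf]
  · linear_combination c * h₂
  · linear_combination c * h₄
  · linear_combination c * h₆

/-- The inhomogeneous term `-12 v W` is the usual correction of `E₂` under a change of weight. -/
theorem rescale {D W v a₂ a₄ a₆ : A} (h : RamanujanSystem δ (D * W ^ 2) 0 a₂ a₄ a₆)
    (hW : δ W = -(D * v * W ^ 2)) :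
    RamanujanSystem δ D (144 * W * δ v) (a₂ * W ^ 2 - 12 * (v * W)) (a₄ * W ^ 4)
      (a₆ * W ^ 6) := by
  have hpow (n : ℕ) : δ (W ^ n) = n * W ^ (n - 1) * δ W := by
    rw [δ.leibniz_pow, smul_eq_mul, nsmul_eq_mul, mul_assoc]
  have h12 : δ (12 : A) = 0 := δ.map_natCast 12
  constructor <;> simp only [map_sub, δ.leibniz, smul_eq_mul, hpow, hW, h12, Nat.cast_ofNat,
    Nat.reduceSub]
  · linear_combination W ^ 2 * h.two
  · linear_combination W ^ 4 * h.four
  · linear_combination W ^ 6 * h.six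

end RamanujanSystem

theorem X_pow_succ_dvd_iff {R : Type*} [CommRing R] {n : ℕ} {φ : R⟦X⟧} :
    PowerSeries.X ^ (n + 1) ∣ φ ↔ PowerSeries.X ^ n ∣ φ ∧ PowerSeries.coeff n φ = 0 := by
  simp only [PowerSeries.X_pow_dvd_iff, Nat.lt_succ_iff_lt_or_eq, or_imp, forall_and, forall_eq]

theorem coeff_mul_of_X_pow_dvd {R : Type*} [CommRing R] {n : ℕ} {φ : R⟦X⟧}
    (h : PowerSeries.X ^ n ∣ φ) (ψ : R⟦X⟧) :
    PowerSeries.coeff n (ψ * φ) = constantCoeff ψ * PowerSeries.coeff n φ := by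
  obtain ⟨χ, rfl⟩ := h
  rw [mul_left_comm, PowerSeries.coeff_X_pow_mul', PowerSeries.coeff_X_pow_mul']
  simp

theorem coeff_r₄₃₂_mul_qD {n : ℕ} {φ : ℂ⟦X⟧} (h : PowerSeries.X ^ n ∣ φ) :
    PowerSeries.coeff n (r₄₃₂ * qD φ) = n * PowerSeries.coeff n φ := by
  have hD : PowerSeries.X ^ n ∣ qD φ := PowerSeries.X_pow_dvd_iff.2 fun m hm => by
    rw [coeff_qD, PowerSeries.X_pow_dvd_iff.1 h m hm, mul_zero]
  rw [coeff_mul_of_X_pow_dvd hD, constantCoeff_r₄₃₂, coeff_qD, one_mul]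

/-- The recursion for the coefficients of a solution of Ramanujan's equations degenerates, with
determinant `72 n² (n - 1)`, only at `n = 0` and `n = 1`. -/
theorem eq_zero_of_ramanujan_recursion {n : ℕ} {t₂ t₄ t₆ : ℂ} (h₂ : 12 * (n * t₂) = 2 * t₂ - t₄)
    (h₄ : 3 * (n * t₄) = t₄ + t₂ - t₆) (h₆ : 2 * (n * t₆) = t₆ + t₂ - 2 * t₄)
    (h : n < 2 → t₄ = 0) : t₂ = 0 ∧ t₄ = 0 ∧ t₆ = 0 := by
  have ht₂ : t₂ = 0 := by
    rcases lt_or_ge n 2 with hn | hn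
    · have h0 := h hn
      interval_cases n <;> norm_num [h0] at h₂ <;> exact h₂
    · obtain ⟨k, rfl⟩ := Nat.exists_eq_add_of_le hn
      have hk : 72 * ((k : ℂ) + 2) ^ 2 * (k + 1) ≠ 0 := by
        norm_cast
        positivity
      refine (mul_eq_zero.1 (?_ : 72 * ((k : ℂ) + 2) ^ 2 * (k + 1) * t₂ = 0)).resolve_left hk
      push_cast at h₂ h₄ h₆
      linear_combination h₆ - (2 * k + 3) * h₄ + ((2 * k + 3) * (3 * k + 5) - 2) * h₂
  have ht₄ : t₄ = 0 := by linear_combination h₂ + (2 - 12 * n) * ht₂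
  exact ⟨ht₂, ht₄, by linear_combination h₄ + (1 - 3 * n) * ht₄ + ht₂⟩

theorem RamanujanSystem.eq_s₈₆₄ {b₂ b₄ b₆ : ℂ⟦X⟧}
    (h : RamanujanSystem (r₄₃₂ • qD) 1 (8640 * (PowerSeries.X * r₄₃₂)) b₂ b₄ b₆)
    (c₂ : constantCoeff b₂ = 1) (c₄ : constantCoeff b₄ = 1)
    (c₄' : PowerSeries.coeff 1 b₄ = 0) : b₂ = s₈₆₄ ∧ b₄ = 1 ∧ b₆ = s₈₆₄ := by
  have hX := X_mul_r₄₃₂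
  obtain ⟨h₂, h₄, h₆⟩ := h
  simp only [Derivation.smul_apply, smul_eq_mul] at h₂ h₄ h₆
  have d₂ : 12 * (r₄₃₂ * qD (b₂ - s₈₆₄)) = (b₂ + s₈₆₄) * (b₂ - s₈₆₄) - (b₄ - 1) := by
    rw [map_sub, qD_s₈₆₄]; linear_combination h₂ + hX
  have d₄ : 3 * (r₄₃₂ * qD (b₄ - 1)) = b₂ * (b₄ - 1) + (b₂ - s₈₆₄) - (b₆ - s₈₆₄) := by
    rw [map_sub, qD.map_one_eq_zero]; linear_combination h₄
  have d₆ : 2 * (r₄₃₂ * qD (b₆ - s₈₆₄)) =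
      b₂ * (b₆ - s₈₆₄) + s₈₆₄ * (b₂ - s₈₆₄) - (b₄ + 1) * (b₄ - 1) := by
    rw [map_sub, qD_s₈₆₄]; linear_combination h₆ + hX
  have hdvd (n : ℕ) : PowerSeries.X ^ n ∣ b₂ - s₈₆₄ ∧ PowerSeries.X ^ n ∣ b₄ - 1 ∧
      PowerSeries.X ^ n ∣ b₆ - s₈₆₄ := by
    induction n with
    | zero => simp
    | succ n ih =>
      obtain ⟨i₂, i₄, i₆⟩ := ih
      have t₂ := congrArg (PowerSeries.coeff n) d₂
      have t₄ := congrArg (PowerSeries.coeff n) d₄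
      have t₆ := congrArg (PowerSeries.coeff n) d₆
      rw [map_sub _ (_ * _), coeff_mul_of_X_pow_dvd i₂, coeff_ofNat_mul,
        coeff_r₄₃₂_mul_qD i₂] at t₂
      rw [map_sub _ (_ + _), map_add, coeff_mul_of_X_pow_dvd i₄, coeff_ofNat_mul,
        coeff_r₄₃₂_mul_qD i₄] at t₄
      rw [map_sub _ (_ + _), map_add, coeff_mul_of_X_pow_dvd i₂, coeff_mul_of_X_pow_dvd i₄,
        coeff_mul_of_X_pow_dvd i₆, coeff_ofNat_mul, coeff_r₄₃₂_mul_qD i₆] at t₆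
      simp only [map_add, map_one, c₂, c₄, constantCoeff_s₈₆₄, one_mul, one_add_one_eq_two]
        at t₂ t₄ t₆
      have hlow (hn : n < 2) : PowerSeries.coeff n (b₄ - 1) = 0 := by
        interval_cases n <;> simp [c₄, c₄', PowerSeries.coeff_one]
      obtain ⟨z₂, z₄, z₆⟩ := eq_zero_of_ramanujan_recursion t₂ t₄ t₆ hlow
      exact ⟨X_pow_succ_dvd_iff.2 ⟨i₂, z₂⟩, X_pow_succ_dvd_iff.2 ⟨i₄, z₄⟩,
        X_pow_succ_dvd_iff.2 ⟨i₆, z₆⟩⟩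
  exact ⟨eq_of_forall_pow_dvd PowerSeries.constantCoeff_X fun n => (hdvd n).1,
    eq_of_forall_pow_dvd PowerSeries.constantCoeff_X fun n => (hdvd n).2.1,
    eq_of_forall_pow_dvd PowerSeries.constantCoeff_X fun n => (hdvd n).2.2⟩

end Ramanujan

/-! ### The normalised Eisenstein series -/

section WeightFactor

open MvPowerSeries

theorem euler_one_inc (φ : ℂ⟦X⟧) : euler 1 (inc φ) = 0 := col_ext fun m => by
  rcases eq_or_ne m 0 with rfl | hm
  · simp [col_euler_one]
  · simp [col_euler_one, col_inc, hm]

theorem col₀_inc (φ : ℂ⟦X⟧) : col₀ (inc φ) = φ := by rw [col₀_apply, col_inc, if_pos rfl]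

theorem mem_filCol_zero {j : ℤ} {F : Ser} : F ∈ filCol j 0 ↔ col 0 F ∈ sPoly j := by
  simp [mem_filCol]

theorem col_zero_eq_zero_of_mem_fil {j : ℤ} (hj : j < 0) {F : Ser} (h : F ∈ fil j) :
    col 0 F = 0 :=
  eq_zero_of_mem_sPoly hj (mem_filCol_zero.1 (mem_fil.1 h 0))

theorem euler_one_mem_filCol_iff {j : ℤ} {m : ℕ} (hm : m ≠ 0) {F : Ser} :
    euler 1 F ∈ filCol j m ↔ F ∈ filCol j m := by
  rw [mem_filCol, mem_filCol, col_euler_one, mul_smul_comm,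
    Submodule.smul_mem_iff _ (Nat.cast_ne_zero.2 hm)]

theorem mul_mem_filCol_of_le {i j : ℤ} {m : ℕ} {F G : Ser} (hF : ∀ n ≤ m, F ∈ filCol i n)
    (hG : ∀ n ≤ m, G ∈ filCol j n) : F * G ∈ filCol (i + j) m :=
  mul_mem_filCol fun _ hp => Or.inr ⟨hF _ (Finset.HasAntidiagonal.antidiagonal.fst_le hp),
    hG _ (Finset.HasAntidiagonal.antidiagonal.snd_le hp)⟩

/-- Since `D` is divisible by `z₂`, the equations determine each column from the preceding ones. -/
theorem RamanujanSystem.mem_fil {D a₂ a₄ a₆ : Ser} (h : RamanujanSystem (eulerD 1) D 0 a₂ a₄ a₆)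
    (hD : D ∈ fil (-1)) (c₂ : col 0 a₂ ∈ sPoly 1) (c₄ : col 0 a₄ ∈ sPoly 0)
    (c₆ : col 0 a₆ ∈ sPoly 1) : a₄ ∈ fil 0 ∧ a₆ ∈ fil 1 := by
  have hD₀ := col_zero_eq_zero_of_mem_fil (by norm_num) hD
  suffices hcol : ∀ m, a₂ ∈ filCol 1 m ∧ a₄ ∈ filCol 0 m ∧ a₆ ∈ filCol 1 m from
    ⟨X18.mem_fil.2 fun m => (hcol m).2.1, X18.mem_fil.2 fun m => (hcol m).2.2⟩
  intro m
  induction m using Nat.strong_induction_on with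
  | _ m ih =>
    rcases eq_or_ne m 0 with rfl | hm
    · exact ⟨mem_filCol_zero.2 c₂, mem_filCol_zero.2 c₄, mem_filCol_zero.2 c₆⟩
    have mul {i j : ℤ} {F G : Ser} (hF : ∀ n < m, F ∈ filCol i n) (hG : ∀ n < m, G ∈ filCol j n)
        (n : ℕ) (hn : n < m) : F * G ∈ filCol (i + j) n :=
      mul_mem_filCol_of_le (fun k hk => hF k (hk.trans_lt hn)) fun k hk => hG k (hk.trans_lt hn)
    have i₂ n hn := (ih n hn).1
    have i₄ n hn := (ih n hn).2.1
    have i₆ n hn := (ih n hn).2.2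
    have step {j : ℤ} {F : Ser} (hF : ∀ n < m, F ∈ filCol (1 + j) n) : D * F ∈ filCol j m := by
      simpa using mul_mem_filCol_of_lt hD hD₀ hF
    refine ⟨?_, ?_, ?_⟩
    · rw [← euler_one_mem_filCol_iff hm, ← ofNat_mul_mem_iff 12, ← eulerD_apply, h.two, sub_zero,
        pow_two]
      exact step fun n hn => sub_mem (mul i₂ i₂ n hn) (filCol_le_add_two 0 n (i₄ n hn))
    · rw [← euler_one_mem_filCol_iff hm, ← ofNat_mul_mem_iff 3, ← eulerD_apply, h.four]
      exact step fun n hn => sub_mem (mul i₂ i₄ n hn) (i₆ n hn)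
    · rw [← euler_one_mem_filCol_iff hm, ← ofNat_mul_mem_iff 2, ← eulerD_apply, h.six, pow_two]
      exact step fun n hn =>
        sub_mem (mul i₂ i₆ n hn) (filCol_le_add_two 0 n (mul i₄ i₄ n hn))

theorem exists_col₀_qE_eq : ∃ u, PowerSeries.constantCoeff u = 1 ∧ col₀ qE = PowerSeries.X * u := by
  refine ⟨col 0 ((PowerSeries.exp ℂ).subst logqE), ?_, ?_⟩
  · rw [constantCoeff_col_zero,
      constantCoeff_subst_of_constantCoeff_eq_zero (by simp [logqE, S_constantCoeff]),
      PowerSeries.constantCoeff_exp]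
  · rw [col₀_apply, qE, ← inc_X, col_inc_mul, logqE]

theorem coeff_one_col₀_atEHom (φ : ℂ⟦X⟧) :
    PowerSeries.coeff 1 (col₀ (atEHom φ)) = PowerSeries.coeff 1 φ := by
  obtain ⟨u, hu, hqE⟩ := exists_col₀_qE_eq
  rw [PowerSeries.eq_X_mul_shift_add_const φ, ← PowerSeries.algebraMap_eq]
  simp only [map_add, map_mul, AlgHom.commutes, atEHom_X, hqE, mul_assoc]
  simp [PowerSeries.coeff_succ_X_mul, hu, col₀_apply, constantCoeff_col_zero,
    constantCoeff_atEHom]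

theorem exists_periods_factor : ∃ P ∈ fil 0, ∃ T ∈ fil (-1), col 0 P = 1 ∧
    X₀ = P * (inc f₀ + T * inc v₀) ∧ S = P * (inc g₀ + T * inc u₀) := by
  obtain ⟨P, hP, Q, hQ, hP₀, hX, hS⟩ := exists_periods_eq
  have hPinv := mul_inv_cancel_of_constantCoeff_eq_one (constantCoeff_eq_one_of_col_zero hP₀)
  have hT : Q * P⁻¹ ∈ fil (-1) := by simpa using SetLike.mul_mem_graded hQ (inv_mem_fil hP hP₀)
  refine ⟨P, hP, Q * P⁻¹, hT, hP₀, ?_, ?_⟩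
  · linear_combination hX - Q * inc v₀ * hPinv
  · linear_combination hS - Q * inc u₀ * hPinv

/-- The factor `W` has weight `-1`: it is `P / X₀` for the `P` of `exists_periods_factor`. -/
theorem exists_inverse_weight : ∃ T ∈ fil (-1), ∃ W : Ser,
    X₀ * W ∈ fil 0 ∧ col 0 (X₀ * W) = 1 ∧ f₀ * col₀ W = 1 ∧ f₀ * col₀ logqE = g₀ ∧
    euler 1 logqE = euler 1 T * W ^ 2 ∧ euler 1 W = -(euler 1 T * inc v₀ * W ^ 2) := by
  obtain ⟨P, hP, T, hT, hP₀, hX, hS⟩ := exists_periods_factor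
  have hT₀ : col₀ T = 0 := col_zero_eq_zero_of_mem_fil (by norm_num) hT
  obtain ⟨w, hw⟩ : ∃ w, w = inc f₀ + T * inc v₀ := ⟨_, rfl⟩
  rw [← hw] at hX
  have hw₀ : col₀ w = f₀ := by rw [hw, map_add, map_mul, hT₀, col₀_inc, zero_mul, add_zero]
  have hwW : w * w⁻¹ = 1 := mul_inv_cancel_of_constantCoeff_eq_one
    (by rw [← constantCoeff_col_zero, ← col₀_apply, hw₀, constantCoeff_f₀])
  have hXW : X₀ * w⁻¹ = P := by rw [hX, mul_assoc, hwW, mul_one]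
  have hlog : w * logqE = inc g₀ + T * inc u₀ := by
    have hPX : P * X₀⁻¹ * w = 1 := by
      rw [mul_right_comm, ← hX]
      exact mul_inv_cancel_of_constantCoeff_eq_one X₀_constantCoeff
    rw [logqE, hS]
    linear_combination (inc g₀ + T * inc u₀) * hPX
  have hwronskian : inc u₀ * inc f₀ - inc v₀ * inc g₀ = 1 := by
    rw [← map_mul, ← map_mul, ← map_sub, wronskian, map_one]
  have hw₁ : euler 1 w = euler 1 T * inc v₀ := by
    rw [hw, map_add, euler_mul, euler_one_inc, euler_one_inc]; ring
  refine ⟨T, hT, w⁻¹, hXW ▸ hP, by rw [hXW, hP₀], ?_, ?_, ?_, ?_⟩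
  · rw [← hw₀, ← map_mul, hwW, map_one]
  · rw [← hw₀, ← map_mul, hlog, map_add, map_mul, hT₀, col₀_inc, zero_mul, add_zero]
  · have hθ := congrArg (euler 1) hlog
    rw [euler_mul, map_add, euler_mul, euler_one_inc, euler_one_inc, hw₁] at hθ
    have hsq : w ^ 2 * euler 1 logqE = euler 1 T := by
      linear_combination w * hθ - euler 1 T * inc v₀ * hlog + euler 1 T * inc u₀ * hw
        + euler 1 T * hwronskian
    linear_combination w⁻¹ ^ 2 * hsq - euler 1 logqE * (w * w⁻¹ + 1) * hwW
  · rw [euler_inv, hw₁]; ring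

theorem ramanujanSystem_atEHom (i : Fin 2) :
    RamanujanSystem (eulerD i) (euler i logqE + if i = 0 then 1 else 0) 0
      (atEHom e2) (atEHom e4) (atEHom e6) := by
  simpa using ramanujanSystem_qD.map atEHom _ (euler_atEHom i)

theorem ramanujanSystem_col₀_atEHom {W : ℂ⟦X⟧} (hW : f₀ * W = 1) (hlog : f₀ * col₀ logqE = g₀) :
    RamanujanSystem (r₄₃₂ • qD) 1 (8640 * (PowerSeries.X * r₄₃₂))
      (col₀ (atEHom e2) * W ^ 2 - 12 * (v₀ * W)) (col₀ (atEHom e4) * W ^ 4)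
      (col₀ (atEHom e6) * W ^ 6) := by
  have hθ : r₄₃₂ * (1 + qD (col₀ logqE)) = W ^ 2 := by
    have hwronskian := wronskian
    have hD := congrArg qD hlog
    rw [qD.leibniz, smul_eq_mul, smul_eq_mul] at hD
    simp only [u₀, v₀] at hwronskian
    linear_combination W ^ 2 * hwronskian + W ^ 2 * r₄₃₂ * f₀ * hD -
      W ^ 2 * r₄₃₂ * qD f₀ * hlog - r₄₃₂ * (1 + qD (col₀ logqE)) * (f₀ * W + 1) * hW
  have hDW : r₄₃₂ * qD W = -(v₀ * W ^ 2) := by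
    have hD := congrArg qD hW
    rw [qD.leibniz, qD.map_one_eq_zero, smul_eq_mul, smul_eq_mul] at hD
    rw [v₀]
    linear_combination r₄₃₂ * W * hD - r₄₃₂ * qD W * hW
  have hcol (F : Ser) : col₀ (euler 0 F) = qD (col₀ F) := col_euler_zero 0 F
  have hsys := (ramanujanSystem_atEHom 0).map col₀ (δ' := r₄₃₂ • qD) r₄₃₂ fun F => by
    rw [Derivation.smul_apply, smul_eq_mul, eulerD_apply, hcol]
  rw [if_pos rfl, map_add, map_one, hcol, add_comm, hθ, map_zero, mul_zero,
    ← one_mul (W ^ 2)] at hsys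
  have hsys' := hsys.rescale (v := v₀) (by simpa using hDW)
  have hsource : 144 * W * (r₄₃₂ • qD) v₀ = 8640 * (PowerSeries.X * r₄₃₂) := by
    rw [Derivation.smul_apply, smul_eq_mul, qD_v₀_and_qD_u₀.1]
    linear_combination 8640 * PowerSeries.X * r₄₃₂ * hW
  rwa [hsource] at hsys'

/-- On `z₂ = 0` the mirror map reduces to the elliptic one, and `s = E₆ / E₄ ^ (3 / 2)`. -/
theorem col₀_atEHom_mul_pow {W : ℂ⟦X⟧} (hW : f₀ * W = 1) (hlog : f₀ * col₀ logqE = g₀) :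
    col₀ (atEHom e2) * W ^ 2 - 12 * (v₀ * W) = s₈₆₄ ∧ col₀ (atEHom e4) * W ^ 4 = 1 ∧
      col₀ (atEHom e6) * W ^ 6 = s₈₆₄ := by
  have hW₀ : PowerSeries.constantCoeff W = 1 := by
    simpa [constantCoeff_f₀] using congrArg PowerSeries.constantCoeff hW
  have hW₁ : PowerSeries.coeff 1 W = -60 := by
    have h := congrArg (PowerSeries.coeff 1) hW
    rw [PowerSeries.coeff_one_mul, constantCoeff_f₀, coeff_one_f₀, hW₀] at h
    simp only [PowerSeries.coeff_one, one_ne_zero, if_false] at h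
    linear_combination h
  refine (ramanujanSystem_col₀_atEHom hW hlog).eq_s₈₆₄ ?_ ?_ ?_
  · simp [col₀_apply, constantCoeff_col_zero, constantCoeff_atEHom, constantCoeff_e2, hW₀, v₀,
      constantCoeff_qD]
  · simp [col₀_apply, constantCoeff_col_zero, constantCoeff_atEHom, constantCoeff_e4, hW₀]
  · have he₄ : PowerSeries.coeff 1 e4 = 240 := ModularForm.E₄_qExpansion_coeff_one
    rw [PowerSeries.coeff_one_mul, PowerSeries.coeff_one_pow, hW₁, coeff_one_col₀_atEHom, he₄,
      col₀_apply, constantCoeff_col_zero, constantCoeff_atEHom,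
      constantCoeff_e4, map_pow, hW₀]
    norm_num

theorem exists_weight_factor : ∃ W : Ser, constantCoeff W = 1 ∧
    X₀ * W ∈ fil 0 ∧ col 0 (X₀ * W) = 1 ∧
    atEHom e4 * W ^ 4 ∈ fil 0 ∧ col 0 (atEHom e4 * W ^ 4) = 1 ∧
    atEHom e6 * W ^ 6 ∈ fil 1 ∧ col 0 (atEHom e6 * W ^ 6) = s₈₆₄ := by
  obtain ⟨T, hT, W, hXW, hXW₀, hW₀, hlog₀, hlog, hW⟩ := exists_inverse_weight
  have hWc : constantCoeff W = 1 := by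
    have h := congrArg PowerSeries.constantCoeff hW₀
    rwa [map_mul, constantCoeff_f₀, one_mul, map_one, col₀_apply, constantCoeff_col_zero] at h
  obtain ⟨k₂, k₄, k₆⟩ := col₀_atEHom_mul_pow hW₀ hlog₀
  have hsys := ramanujanSystem_atEHom 1
  rw [hlog, if_neg one_ne_zero, add_zero] at hsys
  have hsys' := hsys.rescale (v := inc v₀) hW
  rw [eulerD_apply, euler_one_inc, mul_zero] at hsys'
  have k₂' : col 0 (atEHom e2 * W ^ 2 - 12 * (inc v₀ * W)) = s₈₆₄ := by
    rw [← k₂, ← col₀_apply]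
    simp only [map_sub, map_mul, map_pow, map_ofNat, col₀_inc]
  rw [← map_pow, ← map_mul, col₀_apply] at k₄ k₆
  obtain ⟨m₄, m₆⟩ := hsys'.mem_fil (euler_one_mem_fil hT) (k₂' ▸ s₈₆₄_mem_sPoly)
    (k₄ ▸ SetLike.one_mem_graded sPoly) (k₆ ▸ s₈₆₄_mem_sPoly)
  exact ⟨W, hWc, hXW, hXW₀, m₄, k₄, m₆, k₆⟩

end WeightFactor

/-! ### Series in powers of `Z` -/

section ZSeries

open MvPowerSeries

theorem col₀_atEHom_injective : Function.Injective (col₀ ∘ atEHom) := by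
  obtain ⟨u, hu, hqE⟩ := exists_col₀_qE_eq
  refine (injective_iff_map_eq_zero (col₀.comp atEHom)).2 fun φ hφ => ?_
  rw [← PowerSeries.X_pow_order_mul_divXPowOrder (f := φ), AlgHom.comp_apply, map_mul, map_mul,
    map_pow, map_pow, atEHom_X, hqE] at hφ
  have hu₀ : u ≠ 0 := fun h => by simp [h] at hu
  have hψ := (mul_eq_zero.1 hφ).resolve_left
    (pow_ne_zero _ (mul_ne_zero PowerSeries.X_ne_zero hu₀))
  rw [← PowerSeries.constantCoeff_divXPowOrder_eq_zero_iff, ← constantCoeff_atEHom,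
    ← constantCoeff_col_zero, ← col₀_apply, hψ, map_zero]

theorem col_zero_ratPow {F : Ser} (h : col 0 F = 1) (r : ℚ) : col 0 (ratPow F r) = 1 := by
  have hF : constantCoeff (F - 1) = 0 := by
    rw [map_sub, constantCoeff_eq_one_of_col_zero h, map_one, sub_self]
  rw [← col₀_apply, ratPow, map_subst_of_map_eq_zero hF col₀ (by simp [col₀_apply, h, col_one]),
    PowerSeries.binomialSeries_constantCoeff, map_one, map_one]

/-- Reduction modulo `z₁`. -/
def modZ₁ : Ser →+* Ser ⧸ Ideal.span {z₁} := Ideal.Quotient.mk _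

theorem modZ₁_eq_iff {F G : Ser} :
    modZ₁ F = modZ₁ G ↔ ∀ m, PowerSeries.constantCoeff (col m F) =
      PowerSeries.constantCoeff (col m G) := by
  rw [modZ₁, Ideal.Quotient.eq, Ideal.mem_span_singleton, z₁, X_dvd_iff]
  simp only [← PowerSeries.coeff_zero_eq_constantCoeff_apply, coeff_col, map_sub, sub_eq_zero]
  refine ⟨fun h m => h _ (ex_zero 0 m), fun h d hd => ?_⟩
  rw [eq_ex d, hd]
  exact h _

theorem modZ₁_z₁ : modZ₁ z₁ = 0 :=
  Ideal.Quotient.eq_zero_iff_mem.2 (Ideal.mem_span_singleton_self z₁)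

theorem constantCoeff_eq_of_modZ₁_eq {F G : Ser} (h : modZ₁ F = modZ₁ G) :
    constantCoeff F = constantCoeff G := by
  simpa only [constantCoeff_col_zero] using modZ₁_eq_iff.1 h 0

theorem modZ₁_atEHom (φ : ℂ⟦X⟧) :
    modZ₁ (atEHom φ) = modZ₁ (C (PowerSeries.constantCoeff φ)) := by
  rw [atEHom_apply, atE, map_subst_of_map_eq_zero qE_constantCoeff]
  rw [qE, map_mul, modZ₁_z₁, zero_mul]

theorem modZ₁_ratPow {F : Ser} (h : modZ₁ F = 1) (r : ℚ) : modZ₁ (ratPow F r) = 1 := by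
  have hF : constantCoeff (F - 1) = 0 := by
    rw [map_sub, constantCoeff_eq_of_modZ₁_eq (h.trans (map_one _).symm), map_one, sub_self]
  rw [ratPow, map_subst_of_map_eq_zero hF modZ₁ (by rw [map_sub, h, map_one, sub_self]),
    PowerSeries.binomialSeries_constantCoeff, map_one, map_one]

theorem modZ₁_inv {F : Ser} (h : modZ₁ F = 1) : modZ₁ F⁻¹ = 1 := by
  have hF := mul_inv_cancel_of_constantCoeff_eq_one (F := F)
    (by rw [constantCoeff_eq_of_modZ₁_eq (h.trans (map_one _).symm), map_one])
  simpa [h] using congrArg modZ₁ hF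

theorem E4_eq_atEHom : E4 = atEHom e4 := (atEHom_apply _).symm

theorem constantCoeff_E4 : constantCoeff E4 = 1 := by
  rw [E4_eq_atEHom, constantCoeff_atEHom, constantCoeff_e4]

theorem modZ₁_E4 : modZ₁ E4 = 1 := by
  rw [E4_eq_atEHom, modZ₁_atEHom, constantCoeff_e4, map_one, map_one]

theorem modZ₁_Z : modZ₁ Z = modZ₁ z₂ := by
  rw [Z, map_mul, modZ₁_inv, mul_one]
  simp only [map_mul, map_pow, map_sub, map_one, modZ₁_z₁, mul_zero, sub_zero, one_pow, one_mul,
    modZ₁_ratPow modZ₁_E4]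

theorem exists_Z_eq : ∃ V : Ser, constantCoeff V = 1 ∧ Z = z₂ * V := by
  refine ⟨_, ?_, rfl⟩
  rw [MvPowerSeries.constantCoeff_inv, map_mul, constantCoeff_ratPow constantCoeff_E4]
  simp [z₁]

theorem col_z₂_pow (m n : ℕ) : col m (z₂ ^ n) = if m = n then 1 else 0 := by
  simp [col, columns_z₂, PowerSeries.coeff_X_pow]

theorem col_z₂_pow_mul (n : ℕ) (F : Ser) : col n (z₂ ^ n * F) = col 0 F := by
  simp [col, columns_z₂, PowerSeries.coeff_X_pow_mul']

theorem col_zSeries (c : ℕ → ℂ⟦X⟧) (m : ℕ) :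
    col m (zSeries c) = ∑ n ∈ Finset.range (m + 1), col m (atEHom (c n) * Z ^ n) := by
  ext l
  simp only [coeff_col, map_sum, atEHom_apply]
  change ∑ n ∈ Finset.range (ex l m 1 + 1), coeff (ex l m) (atE (c n) * Z ^ n) = _
  rw [ex_one]

theorem col_zero_zSeries (c : ℕ → ℂ⟦X⟧) : col 0 (zSeries c) = col₀ (atEHom (c 0)) := by
  simp [col_zSeries, col₀_apply]

theorem constantCoeff_col_zSeries (c : ℕ → ℂ⟦X⟧) (m : ℕ) :
    PowerSeries.constantCoeff (col m (zSeries c)) = PowerSeries.constantCoeff (c m) := by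
  have hterm (n : ℕ) : modZ₁ (atEHom (c n) * Z ^ n) =
      modZ₁ (PowerSeries.constantCoeff (c n) • z₂ ^ n) := by
    rw [map_mul, map_pow, modZ₁_Z, modZ₁_atEHom, smul_eq_C_mul, map_mul, map_pow]
  have hcol (n : ℕ) : PowerSeries.constantCoeff (col m (atEHom (c n) * Z ^ n)) =
      if m = n then PowerSeries.constantCoeff (c n) else 0 := by
    rw [modZ₁_eq_iff.1 (hterm n), map_smul, col_z₂_pow]
    split_ifs <;> simp
  rw [col_zSeries, map_sum, Finset.sum_congr rfl fun n _ => hcol n, Finset.sum_ite_eq,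
    if_pos (Finset.self_mem_range_succ m)]

theorem constantCoeff_eq_zero_of_modZ₁_zSeries {c : ℕ → ℂ⟦X⟧} (h : modZ₁ (zSeries c) = 1) {n : ℕ}
    (hn : 1 ≤ n) : PowerSeries.constantCoeff (c n) = 0 := by
  rw [← constantCoeff_col_zSeries, modZ₁_eq_iff.1 (h.trans (map_one _).symm),
    col_one, if_neg (by omega), map_zero]

theorem eq_zSeries {c : ℕ → ℂ⟦X⟧} {F : Ser}
    (h : ∀ M, Z ^ M ∣ F - ∑ n ∈ Finset.range M, atEHom (c n) * Z ^ n) : F = zSeries c := by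
  ext d
  obtain ⟨H, hH⟩ := h (d 1 + 1)
  rw [eq_add_of_sub_eq hH, map_add, mul_comm, coeff_mul_Z_pow _ _ _ (Nat.lt_succ_self _), zero_add,
    map_sum]
  exact Finset.sum_congr rfl fun n _ => by rw [atEHom_apply]

theorem zSeries_injective : Function.Injective zSeries := by
  obtain ⟨V, hV, hZ⟩ := exists_Z_eq
  have hV₀ (n : ℕ) : col₀ (V ^ n) ≠ 0 := fun h => by
    simpa [col₀_apply, constantCoeff_col_zero, hV] using congrArg PowerSeries.constantCoeff h
  have hcol (n : ℕ) (φ : ℂ⟦X⟧) :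
      col n (atEHom φ * Z ^ n) = col₀ (atEHom φ) * col₀ (V ^ n) := by
    rw [hZ, mul_pow, mul_left_comm, ← map_mul]
    exact col_z₂_pow_mul n _
  intro c c' h
  funext n
  induction n using Nat.strong_induction_on with
  | _ n ih =>
    have hn := congrArg (col n) h
    rw [col_zSeries, col_zSeries, Finset.sum_range_succ, Finset.sum_range_succ,
      Finset.sum_congr rfl fun k hk => by rw [ih k (Finset.mem_range.1 hk)], add_right_inj, hcol,
      hcol] at hn
    exact col₀_atEHom_injective (mul_right_cancel₀ (hV₀ n) hn)

theorem isZExpansion_of_eq {F N : Ser} {c : ℕ → ℂ⟦X⟧} (hF : F ≠ 0) (h : F = N * zSeries c) :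
    IsZExpansion F N c := by
  refine ⟨h, fun c' h' => zSeries_injective ?_⟩
  have hN : N ≠ 0 := by rintro rfl; exact hF (by rw [h, zero_mul])
  exact mul_left_cancel₀ hN (h'.symm.trans h)

end ZSeries

/-! ### Expansion of the filtration -/

section Expansion

open MvPowerSeries

theorem exists_eq_zSeries {P : ℕ → Set Ser} {Q : ℕ → ℂ⟦X⟧ → Prop}
    (step : ∀ n, ∀ F ∈ P n, ∃ c, Q n c ∧ ∃ G ∈ P (n + 1), F = atEHom c + G * Z)
    {F : Ser} (hF : F ∈ P 0) : ∃ c : ℕ → ℂ⟦X⟧, (∀ n, Q n (c n)) ∧ F = zSeries c := by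
  choose! c hc G hG hstep using step
  let H (n : ℕ) : Ser := n.rec F G
  have hH (n : ℕ) : H n ∈ P n := n.rec hF fun n => hG n (H n)
  refine ⟨fun n => c n (H n), fun n => hc n _ (hH n), eq_zSeries fun M => ⟨H M, ?_⟩⟩
  induction M with
  | zero => simp [H]
  | succ M ih =>
    rw [Finset.sum_range_succ, ← sub_sub, ih, pow_succ]
    linear_combination Z ^ M * hstep M _ (hH M)

/-- The series `E₆(q_E) / E₄(q_E) ^ (3 / 2)`, of weight `0`. -/
def sE : Ser := atEHom e6 * ratPow E4 (-(3 / 2))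

/-- The series `E₄(q_E) ^ (3 / 2)`. Multiplying by its powers restores the weight of a polynomial
in `sE`. -/
def rE : Ser := ratPow E4 (3 / 2)

theorem rE_mul_sE : rE * sE = atEHom e6 := by
  rw [rE, sE, mul_left_comm, ratPow_mul_ratPow_neg constantCoeff_E4, mul_one]

theorem rE_sq : rE ^ 2 = E4 ^ 3 := by
  rw [rE, ratPow_pow constantCoeff_E4, ← ratPow_natCast constantCoeff_E4]
  norm_num

theorem rE_pow_three : rE ^ 3 = ratPow E4 (9 / 2) := by
  rw [rE, ratPow_pow constantCoeff_E4]
  norm_num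

theorem constantCoeff_rE : constantCoeff rE = 1 := constantCoeff_ratPow constantCoeff_E4 _

theorem sE_mem_fil : sE ∈ fil 1 ∧ col 0 sE = s₈₆₄ := by
  obtain ⟨W, hW, -, -, m₄, k₄, m₆, k₆⟩ := exists_weight_factor
  rw [← E4_eq_atEHom] at m₄ k₄
  have hsE : sE = atEHom e6 * W ^ 6 * ratPow (E4 * W ^ 4) (-(3 / 2)) := by
    rw [mul_assoc, pow_mul_ratPow_mul_pow_neg constantCoeff_E4 hW (by norm_num), sE]
  refine ⟨?_, ?_⟩
  · simpa [hsE] using SetLike.mul_mem_graded m₆ (ratPow_mem_fil m₄ k₄ _)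
  · rw [hsE, col_zero_mul, k₆, col_zero_ratPow k₄, mul_one]

theorem X₀_mul_ratPow_mem_fil : X₀ * ratPow E4 (-(1 / 4)) ∈ fil 0 ∧
    col 0 (X₀ * ratPow E4 (-(1 / 4))) = 1 := by
  obtain ⟨W, hW, mX, kX, m₄, k₄, -, -⟩ := exists_weight_factor
  rw [← E4_eq_atEHom] at m₄ k₄
  have hX : X₀ * ratPow E4 (-(1 / 4)) = X₀ * W * ratPow (E4 * W ^ 4) (-(1 / 4)) := by
    rw [← pow_mul_ratPow_mul_pow_neg constantCoeff_E4 hW (n := 4) (k := 1) (by norm_num), pow_one,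
      mul_assoc]
  rw [hX]
  refine ⟨?_, ?_⟩
  · simpa using SetLike.mul_mem_graded mX (ratPow_mem_fil m₄ k₄ _)
  · rw [col_zero_mul, kX, col_zero_ratPow k₄, mul_one]

theorem inc_r₄₃₂ : inc r₄₃₂ = 1 - 432 * z₁ := by
  rw [r₄₃₂, map_sub, map_mul, map_one, map_ofNat, inc_X]

theorem inc_s₈₆₄ : inc s₈₆₄ = 1 - 864 * z₁ := by
  rw [s₈₆₄, map_sub, map_mul, map_one, map_ofNat, inc_X]

/-- The series `z₂ / (1 - 432 z₁) ^ 3`. -/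
def y : Ser := inc (r₄₃₂⁻¹ ^ 3) * z₂

theorem y_mul_pow_three : y * (1 - 432 * z₁) ^ 3 = z₂ := by
  rw [y, ← inc_r₄₃₂, mul_right_comm, ← map_pow, ← map_mul, mul_comm (_ ^ 3),
    r₄₃₂_pow_mul_inv_pow, map_one, one_mul]

theorem y_eq_Z_mul : y = Z * rE ^ 3 := by
  have hinv := mul_inv_cancel_of_constantCoeff_eq_one (F := (1 - 432 * z₁) ^ 3 * rE ^ 3)
    (by simp [z₁, constantCoeff_rE])
  rw [Z, ← rE_pow_three, ← y_mul_pow_three]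
  linear_combination -y * hinv

theorem col_y_mul_zero (F : Ser) : col 0 (y * F) = 0 := by
  rw [y, mul_assoc, col_inc_mul, col_z₂_mul_zero, mul_zero]

theorem col_y_mul_succ (m : ℕ) (F : Ser) : col (m + 1) (y * F) = r₄₃₂⁻¹ ^ 3 * col m F := by
  rw [y, mul_assoc, col_inc_mul, col_z₂_mul_succ]

theorem y_mul_mem_fil_iff {j : ℤ} {F : Ser} : y * F ∈ fil j ↔ F ∈ fil (j + 3) := by
  have hzero : y * F ∈ filCol j 0 := by
    rw [mem_filCol, col_y_mul_zero, mul_zero]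
    exact zero_mem _
  have hsucc (m : ℕ) : y * F ∈ filCol j (m + 1) ↔ F ∈ filCol (j + 3) m := by
    have hpow : r₄₃₂ ^ (3 * (m + 1)) * (r₄₃₂⁻¹ ^ 3 * col m F) = r₄₃₂ ^ (3 * m) * col m F := by
      linear_combination r₄₃₂ ^ (3 * m) * col m F * r₄₃₂_pow_mul_inv_pow 3
    rw [mem_filCol, mem_filCol, col_y_mul_succ, hpow,
      show (3 * (m + 1 : ℕ) + j : ℤ) = 3 * m + (j + 3) by push_cast; ring]
  rw [mem_fil, mem_fil, ← Nat.and_forall_add_one]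
  simp only [hzero, hsucc, true_and]

theorem exists_eq_y_mul {F : Ser} (h : col 0 F = 0) : ∃ G, F = y * G := by
  refine ⟨ofCol fun m => r₄₃₂ ^ 3 * col (m + 1) F, col_ext fun m => ?_⟩
  cases m with
  | zero => rw [col_y_mul_zero, h]
  | succ m =>
    rw [col_y_mul_succ, col_ofCol]
    linear_combination -col (m + 1) F * r₄₃₂_pow_mul_inv_pow 3

theorem exists_isModular_of_mem_parityDegreeLE (d : ℕ) {p : Polynomial ℂ}
    (hp : p ∈ parityDegreeLE ℂ d) :
    ∃ c, IsModular (6 * d) c ∧ atEHom c = Polynomial.aeval sE p * rE ^ d := by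
  induction hp using Submodule.span_induction with
  | mem p hp =>
    obtain ⟨i, k, h, rfl⟩ := hp
    obtain rfl : i + 2 * k = d := by exact_mod_cast h
    refine ⟨e6 ^ i * e4 ^ (3 * k), ?_, ?_⟩
    · convert (isModular_e6.pow i).mul (isModular_e4.pow (3 * k)) using 1
      push_cast; ring
    · rw [map_mul, map_pow, map_pow, map_pow, Polynomial.aeval_X, ← rE_mul_sE, ← E4_eq_atEHom,
        pow_mul, ← rE_sq, ← pow_mul, pow_add, mul_pow]
      ring
  | zero => exact ⟨0, isModular_zero _, by simp⟩
  | add p q _ _ hp hq =>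
    obtain ⟨c, hc, h⟩ := hp
    obtain ⟨c', hc', h'⟩ := hq
    exact ⟨c + c', hc.add hc', by rw [map_add, h, h', map_add, add_mul]⟩
  | smul a p _ hp =>
    obtain ⟨c, hc, h⟩ := hp
    exact ⟨a • c, hc.smul a, by rw [map_smul, h, map_smul, smul_mul_assoc]⟩

/-- The polynomial in `s` that is the leading term of `F` in `y`, evaluated at `sE`, is modular;
the difference is divisible by `y`. -/
theorem exists_mul_rE_pow_eq {d : ℕ} {F : Ser} (hF : F ∈ fil d) :
    ∃ c, IsModular (6 * d) c ∧ ∃ G ∈ fil (d + 3),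
      F * rE ^ d = atEHom c + G * rE ^ (d + 3) * Z := by
  obtain ⟨p, hp, hpF⟩ := mem_sPoly.1 (mem_filCol_zero.1 (mem_fil.1 hF 0))
  obtain ⟨c, hc, hcp⟩ := exists_isModular_of_mem_parityDegreeLE d hp
  have hcol : col 0 (F - Polynomial.aeval sE p) = 0 := by
    rw [map_sub, ← hpF, ← col₀_apply (Polynomial.aeval _ _), ← Polynomial.aeval_algHom_apply,
      col₀_apply, sE_mem_fil.2, sub_self]
  obtain ⟨G, hG⟩ := exists_eq_y_mul hcol
  have hmem := sub_mem hF
    (aeval_mem_of_mem_parityDegreeLE fil fil_le_add_two sE_mem_fil.1 hp)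
  rw [hG, y_mul_mem_fil_iff] at hmem
  refine ⟨c, hc, G, hmem, ?_⟩
  rw [y_eq_Z_mul] at hG
  rw [hcp]
  linear_combination rE ^ d * hG

theorem exists_zSeries_of_mem_fil {j : ℕ} {F : Ser} (hF : F ∈ fil j) :
    ∃ c : ℕ → ℂ⟦X⟧, (∀ n : ℕ, IsModular (18 * n + 6 * j) (c n)) ∧ F * rE ^ j = zSeries c := by
  refine exists_eq_zSeries (P := fun n => {H | ∃ G ∈ fil (j + 3 * n), H = G * rE ^ (j + 3 * n)})
    ?_ ⟨F, by simpa using hF, by simp⟩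
  rintro n _ ⟨G, hG, rfl⟩
  obtain ⟨c, hc, G', hG', h⟩ := exists_mul_rE_pow_eq (d := j + 3 * n) (by exact_mod_cast hG)
  refine ⟨c, ?_, G' * rE ^ (j + 3 * n + 3), ⟨G', ?_, rfl⟩, h⟩
  · convert hc using 1
    push_cast; ring
  · convert hG' using 2
    push_cast; ring

theorem exists_zSeries_of_mem_fil_zero {F : Ser} (hF : F ∈ fil 0) (hF₀ : col 0 F = 1) :
    ∃ c : ℕ → ℂ⟦X⟧, F = zSeries c ∧ c 0 = 1 ∧ ∀ n : ℕ, IsModular (18 * n) (c n) := by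
  obtain ⟨c, hc, h⟩ := exists_zSeries_of_mem_fil (j := 0) hF
  rw [pow_zero, mul_one] at h
  refine ⟨c, h, col₀_atEHom_injective ?_, by simpa using hc⟩
  rw [Function.comp_apply, ← col_zero_zSeries, ← h, hF₀, Function.comp_apply, map_one, map_one]

end Expansion

/-! ### The four expansions -/

section FourExpansions

open MvPowerSeries

theorem one_sub_s₈₆₄_sq_ne_zero : 1 - s₈₆₄ ^ 2 ≠ 0 := by
  rw [← X_mul_r₄₃₂]
  refine fun h => ?_
  simpa [constantCoeff_r₄₃₂, coeff_ofNat_mul, PowerSeries.coeff_succ_X_mul] using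
    congrArg (PowerSeries.coeff 1) h

theorem mul_one_sub_eq_inc : 1728 * (z₁ * (1 - 432 * z₁)) = inc (1 - s₈₆₄ ^ 2) := by
  rw [← X_mul_r₄₃₂, map_mul, map_mul, inc_X, inc_r₄₃₂, map_ofNat]

theorem modZ₁_sE : modZ₁ sE = 1 := by
  rw [sE, map_mul, modZ₁_ratPow modZ₁_E4, modZ₁_atEHom, constantCoeff_e6, map_one, map_one, mul_one]

theorem exists_eq_inc_mul_of_mem_fil {j : ℤ} {F : Ser} (hF : F ∈ fil j) (h : modZ₁ F = 0) :
    ∃ G ∈ fil (j - 2), F = inc (1 - s₈₆₄ ^ 2) * G := by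
  have hc (m : ℕ) : PowerSeries.constantCoeff (r₄₃₂ ^ (3 * m) * col m F) = 0 := by
    rw [map_mul, modZ₁_eq_iff.1 (h.trans (map_zero _).symm), map_zero, map_zero, mul_zero]
  choose ψ hψ hFψ using fun m =>
    exists_eq_one_sub_s₈₆₄_sq_mul (mem_filCol.1 (mem_fil.1 hF m)) (hc m)
  refine ⟨ofCol fun m => r₄₃₂⁻¹ ^ (3 * m) * ψ m, mem_fil.2 fun m => ?_, col_ext fun m => ?_⟩
  · rw [mem_filCol, col_ofCol, ← mul_assoc, r₄₃₂_pow_mul_inv_pow, one_mul, ← add_sub_assoc]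
    exact hψ m
  · rw [col_inc_mul, col_ofCol]
    linear_combination
      r₄₃₂⁻¹ ^ (3 * m) * hFψ m - col m F * r₄₃₂_pow_mul_inv_pow (3 * m)

theorem exists_one_sub_sE_sq : ∃ U ∈ fil 0, col 0 U = 1 ∧
    1 - sE ^ 2 = inc (1 - s₈₆₄ ^ 2) * U := by
  obtain ⟨hs, hs₀⟩ := sE_mem_fil
  have hmem : 1 - sE ^ 2 ∈ fil 2 :=
    sub_mem (fil_le_add_two 0 (SetLike.one_mem_graded fil)) (SetLike.pow_mem_graded 2 hs)
  obtain ⟨U, hU, h⟩ := exists_eq_inc_mul_of_mem_fil hmem (by simp [modZ₁_sE])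
  have hcol := congrArg col₀ h
  rw [map_mul, col₀_inc, map_sub, map_pow, map_one, col₀_apply sE, hs₀] at hcol
  exact ⟨U, by simpa using hU, (mul_eq_left₀ one_sub_s₈₆₄_sq_ne_zero).1 hcol.symm, h⟩

theorem eta24_eq : 1728 * eta24 = E4 ^ 3 * (1 - sE ^ 2) := by
  have h := congrArg atEHom qExp_discriminant
  rw [Algebra.smul_def, map_mul, AlgHom.commutes, map_sub, map_pow, map_pow, map_ofNat,
    ← rE_mul_sE, atEHom_apply (qExp _), ← E4_eq_atEHom] at h
  rw [eta24, h, mul_pow, rE_sq]; ring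

theorem z₁_expansion : ∃ a : ℕ → ℂ⟦X⟧,
    IsZExpansion (z₁ * (1 - 432 * z₁)) (eta24 * (E4 ^ 3)⁻¹) a ∧
      a 0 = 1 ∧ ∀ n : ℕ, IsModular (18 * n) (a n) := by
  obtain ⟨U, hU, hU₀, h⟩ := exists_one_sub_sE_sq
  have hUinv := mul_inv_cancel_of_constantCoeff_eq_one (constantCoeff_eq_one_of_col_zero hU₀)
  have hEinv := mul_inv_cancel_of_constantCoeff_eq_one (F := E4 ^ 3)
    (by rw [map_pow, constantCoeff_E4, one_pow])
  have hUinv₀ : col 0 U⁻¹ = 1 := by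
    simpa [col_zero_mul, hU₀, col_one] using congrArg (col 0) hUinv
  obtain ⟨a, ha, ha₀, hmod⟩ := exists_zSeries_of_mem_fil_zero (inv_mem_fil hU hU₀) hUinv₀
  refine ⟨a, isZExpansion_of_eq (fun h₀ => one_sub_s₈₆₄_sq_ne_zero ?_) ?_, ha₀, hmod⟩
  · rw [← col₀_inc (1 - s₈₆₄ ^ 2), ← mul_one_sub_eq_inc, h₀, mul_zero, map_zero]
  · have : CharZero Ser := charZero_of_injective_algebraMap (algebraMap ℂ Ser).injective
    refine mul_left_cancel₀ (OfNat.ofNat_ne_zero 1728) ?_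
    rw [mul_one_sub_eq_inc, ← ha]
    linear_combination -(E4 ^ 3)⁻¹ * U⁻¹ * eta24_eq - (1 - sE ^ 2) * U⁻¹ * hEinv
      - U⁻¹ * h - inc (1 - s₈₆₄ ^ 2) * hUinv

theorem discriminant_eq : Δ₁ * Δ₂ * ((1 - 432 * z₁) ^ 3)⁻¹ =
    1 + (27 / 4 : ℂ) • (y * inc (3 * s₈₆₄ + s₈₆₄ ^ 3))
      - (27 ^ 2 / 64 : ℂ) • (y * (y * inc ((1 - s₈₆₄ ^ 2) ^ 3))) := by
  refine smul_right_injective Ser (by norm_num : (64 : ℂ) ≠ 0) ?_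
  have hinv := mul_inv_cancel_of_constantCoeff_eq_one (F := (1 - 432 * z₁) ^ 3) (by simp [z₁])
  dsimp only
  rw [smul_sub, smul_add, smul_smul, smul_smul]
  norm_num only
  simp only [Algebra.smul_def, map_ofNat, map_add, map_mul, map_pow, map_sub, map_one, inc_s₈₆₄]
  rw [Δ₁, Δ₂, ← y_mul_pow_three]
  linear_combination 64 * (1 - 27 * y * (432 * z₁) ^ 3)
    * (1 + 27 * (y * (1 - 432 * z₁) ^ 3)) * hinv

theorem discriminant_mem_fil : Δ₁ * Δ₂ * ((1 - 432 * z₁) ^ 3)⁻¹ ∈ fil 0 ∧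
    col 0 (Δ₁ * Δ₂ * ((1 - 432 * z₁) ^ 3)⁻¹) = 1 := by
  have hlinear : 3 * s₈₆₄ + s₈₆₄ ^ 3 ∈ sPoly 3 :=
    add_mem ((ofNat_mul_mem_iff 3).2 (sPoly_le_add_two 1 s₈₆₄_mem_sPoly))
      (SetLike.pow_mem_graded 3 s₈₆₄_mem_sPoly)
  have hquadratic : (1 - s₈₆₄ ^ 2) ^ 3 ∈ sPoly 6 :=
    SetLike.pow_mem_graded 3
      (sub_mem one_mem_sPoly_two (SetLike.pow_mem_graded 2 s₈₆₄_mem_sPoly))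
  rw [discriminant_eq]
  refine ⟨sub_mem (add_mem (SetLike.one_mem_graded fil) (Submodule.smul_mem _ _ ?_))
    (Submodule.smul_mem _ _ ?_), ?_⟩
  · exact y_mul_mem_fil_iff.2 (inc_mem_fil hlinear)
  · exact y_mul_mem_fil_iff.2 (y_mul_mem_fil_iff.2 (inc_mem_fil hquadratic))
  · rw [map_sub, map_add, map_smul, map_smul, col_y_mul_zero, col_y_mul_zero, col_one]
    simp

theorem discriminant_expansion : ∃ b : ℕ → ℂ⟦X⟧,
    IsZExpansion (Δ₁ * Δ₂ * ((1 - 432 * z₁) ^ 3)⁻¹) 1 b ∧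
      b 0 = 1 ∧ ∀ n : ℕ, IsModular (18 * n) (b n) := by
  obtain ⟨h, h₀⟩ := discriminant_mem_fil
  obtain ⟨b, hb, hb₀, hmod⟩ := exists_zSeries_of_mem_fil_zero h h₀
  refine ⟨b, isZExpansion_of_eq (fun hzero => ?_) (by rw [one_mul, hb]), hb₀, hmod⟩
  rw [hzero, map_zero] at h₀
  exact zero_ne_one h₀

theorem s_expansion : ∃ c : ℕ → ℂ⟦X⟧, IsZExpansion (1 - 864 * z₁) (ratPow E4 (3 / 2))⁻¹ c ∧
      c 0 = qExp ModularForm.E₆ ∧ (∀ n : ℕ, IsModular (18 * n + 6) (c n)) ∧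
      ∀ n : ℕ, 1 ≤ n → IsEtaDivisible (18 * n + 6) (c n) := by
  obtain ⟨c, hmod, hc⟩ := exists_zSeries_of_mem_fil (j := 1) (inc_mem_fil s₈₆₄_mem_sPoly)
  simp only [Nat.cast_one, mul_one] at hmod
  rw [pow_one] at hc
  have hrE := mul_inv_cancel_of_constantCoeff_eq_one constantCoeff_rE
  refine ⟨c, isZExpansion_of_eq (fun hzero => ?_) ?_, col₀_atEHom_injective ?_, hmod, fun n hn =>
    (hmod n).isEtaDivisible (constantCoeff_eq_zero_of_modZ₁_zSeries ?_ hn)⟩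
  · simpa [z₁] using congrArg constantCoeff hzero
  · rw [← rE, ← inc_s₈₆₄, ← hc]
    linear_combination -inc s₈₆₄ * hrE
  · change col₀ (atEHom (c 0)) = col₀ (atEHom e6)
    rw [← col_zero_zSeries, ← hc, ← rE_mul_sE, ← col₀_apply, map_mul, map_mul, col₀_inc,
      col₀_apply sE, sE_mem_fil.2, mul_comm]
  · rw [← hc, map_mul, inc_s₈₆₄, rE, modZ₁_ratPow modZ₁_E4]
    simp [modZ₁_z₁]

theorem modZ₁_X₀ : modZ₁ X₀ = 1 := by
  rw [← map_one modZ₁, modZ₁_eq_iff]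
  intro m
  rw [← PowerSeries.coeff_zero_eq_constantCoeff_apply, coeff_col, coeff_X₀, col_one, periodCoeff]
  rcases eq_or_ne m 0 with rfl | hm
  · simp
  · simp [hm]

theorem X₀_expansion : ∃ x : ℕ → ℂ⟦X⟧, IsZExpansion X₀ (ratPow E4 (1 / 4)) x ∧
      x 0 = 1 ∧ (∀ n : ℕ, IsModular (18 * n) (x n)) ∧
      ∀ n : ℕ, 1 ≤ n → IsEtaDivisible (18 * n) (x n) := by
  obtain ⟨h, h₀⟩ := X₀_mul_ratPow_mem_fil
  obtain ⟨x, hx, hx₀, hmod⟩ := exists_zSeries_of_mem_fil_zero h h₀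
  refine ⟨x, isZExpansion_of_eq (fun hzero => ?_) ?_, hx₀, hmod, fun n hn =>
    (hmod n).isEtaDivisible (constantCoeff_eq_zero_of_modZ₁_zSeries ?_ hn)⟩
  · simpa [hzero] using X₀_constantCoeff
  · rw [← hx, mul_left_comm, ratPow_mul_ratPow_neg constantCoeff_E4, mul_one]
  · rw [← hx, map_mul, modZ₁_X₀, modZ₁_ratPow modZ₁_E4, mul_one]

end FourExpansions

end X18

end

theorem mainTheorem2 :
    (∃ a : ℕ → ℂ⟦X⟧, IsZExpansion (z₁ * (1 - 432 * z₁)) (eta24 * (E4 ^ 3)⁻¹) a ∧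
      a 0 = 1 ∧ ∀ n : ℕ, IsModular (18 * n) (a n)) ∧
    (∃ b : ℕ → ℂ⟦X⟧, IsZExpansion (Δ₁ * Δ₂ * ((1 - 432 * z₁) ^ 3)⁻¹) 1 b ∧
      b 0 = 1 ∧ ∀ n : ℕ, IsModular (18 * n) (b n)) ∧
    (∃ c : ℕ → ℂ⟦X⟧, IsZExpansion (1 - 864 * z₁) (ratPow E4 (3 / 2))⁻¹ c ∧
      c 0 = qExp ModularForm.E₆ ∧ (∀ n : ℕ, IsModular (18 * n + 6) (c n)) ∧
      ∀ n : ℕ, 1 ≤ n → IsEtaDivisible (18 * n + 6) (c n)) ∧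
    (∃ x : ℕ → ℂ⟦X⟧, IsZExpansion X₀ (ratPow E4 (1 / 4)) x ∧
      x 0 = 1 ∧ (∀ n : ℕ, IsModular (18 * n) (x n)) ∧
      ∀ n : ℕ, 1 ≤ n → IsEtaDivisible (18 * n) (x n)) :=
  ⟨z₁_expansion, discriminant_expansion, s_expansion, X₀_expansion⟩
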